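/- Let $(M^{2n+1},\varphi,\xi,\eta,g)$ be a (smooth) almost contact metric manifold, i.e. $g$ is a Riemannian metric and $\varphi$, $\xi$, $\eta$ are a smooth endomorphism field, vector field and 1-form with $\varphi^2=-I+\eta\otimes\xi$, $\eta(\xi)=1$, $g(\varphi X,\varphi Y)=g(X,Y)-\eta(X)\eta(Y)$. Let $\Phi(X,Y)=g(X,\varphi Y)$, let $\nabla^g$ be the Levi-Civita connection and $H=\ker\eta$. The manifold is *$H$-parallel* if $(\nabla^g_X\Phi)(Y,Z)=0$ for all $X,Y,Z\in H$. A *characteristic connection* is a connection $\nabla$ on $TM$ with $\nabla g=0$, $\nabla\varphi=0$, $\nabla\xi=0$, $\nabla\eta=0$ whose torsion $T(X,Y,Z)=g(T(X,Y),Z)$ is totally skew-symmetric. On a tangent space $V=T_pM$ let $\mathcal C(V)$ be the space of $(0,3)$-tensors $\alpha$ with $$\alpha(X,Y,Z)=-\alpha(X,Z,Y)=-\alpha(X,\varphi Y,\varphi Z)+\eta(Y)\alpha(X,\xi,Z)+\eta(Z)\alpha(X,Y,\xi);$$ it contains $(\nabla^g\Phi)_p$. For $\alpha\in\mathcal C(V)$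 write $\delta\Phi(Z)=-\sum_i\alpha(e_i,e_i,Z)$ for an orthonormal basis $(e_i)$, and $(\nabla_X\eta)(Y)=\alpha(X,\xi,\varphi Y)$; for $\alpha=(\nabla^g\Phi)_p$ these are the usual codifferential of $\Phi$ and $\nabla^g\eta$. Consider the following subspaces of $\mathcal C(V)$, each given by the indicated conditions for all $X,Y,Z\in V$: - $\mathcal C_1$: $\alpha(X,X,Y)=0$ and $\nabla\eta=0$; - $\mathcal C_3$: $\alpha(X,Y,Z)=\alpha(\varphi X,\varphi Y,Z)$ and $\delta\Phi=0$; - $\mathcal C_4$ (with $\mathcal C_4=0$ if $n=1$): $\delta\Phi(\xi)=0$ and $\alpha(X,Y,Z)=-\frac1{2(n-1)}\big[g(\varphi X,\varphi Y)\delta\Phi(Z)-g(\varphi X,\varphi Z)\delta\Phi(Y)-\Phi(X,Y)\delta\Phi(\varphi Z)+\Phi(X,Z)\delta\Phi(\varphi Y)\big]$; - $\mathcal C_6$: $\alpha(X,Y,Z)=\frac1{2n}\big[\eta(Y)g(X,Z)-\eta(Z)g(X,Y)\big]\delta\Phi(\xi)$; - $\mathcal C_7$: $\alpha(X,Y,Z)=\eta(Z)(\nabla_Y\eta)(\varphi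 X)+\eta(Y)(\nabla_{\varphi X}\eta)(Z)$ and $\delta\Phi=0$; - $\mathcal D_2$: $\alpha(X,Y,Z)=\eta(X)\alpha(\xi,Y,Z)+\eta(Y)\alpha(X,\xi,Z)+\eta(Z)\alpha(X,Y,\xi)$; - $\mathcal D_3$: $\alpha(X,Y,Z)=\eta(X)\eta(Y)\alpha(\xi,\xi,Z)+\eta(X)\eta(Z)\alpha(\xi,Y,\xi)$. To $\alpha$ associate the endomorphisms $S$, $P$, $h$ of $V$ with $g(SX,Z)=\alpha(X,\xi,Z)$, $g(PY,Z)=\alpha(\xi,Y,Z)$ and $P=-2h+\varphi S\varphi+S$, and put $\mathcal C_{\min}=\{\alpha\in\mathcal D_2\oplus\mathcal D_3 : h=2S\}$. A manifold is *of class $\mathcal U$* if $(\nabla^g\Phi)_p\in\mathcal U$ at every point $p$. (1) If the manifold is $H$-parallel, then it admits a characteristic connection if and only if it is of class $\mathcal C_6\oplus\mathcal C_7\oplus\mathcal C_{\min}$; the torsion of any characteristic connection is then $T=\eta\wedge d\eta$, i.e. $T(X,Y,Z)=\eta(X)d\eta(Y,Z)+\eta(Y)d\eta(Z,X)+\eta(Z)d\eta(X,Y)$,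 with $d\eta(X,Y)=X\eta(Y)-Y\eta(X)-\eta([X,Y])$. (2) In general (without $H$-parallelism), the manifold admits a characteristic connection if and only if it is of class $\mathcal C_1\oplus\mathcal C_3\oplus\mathcal C_4\oplus\mathcal C_6\oplus\mathcal C_7\oplus\mathcal C_{\min}$. -/

import Mathlib

open scoped InnerProductSpace

noncomputable section

/-- Tensors of type `(0,3)` on `V`; `α X Y Z` is written `α(X, Y, Z)` on paper. -/
abbrev Tensor3 (V : Type*) [NormedAddCommGroup V] [InnerProductSpace ℝ V] : Type _ :=
  V →ₗ[ℝ] V →ₗ[ℝ] V →ₗ[ℝ] ℝ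

/-- An almost contact metric structure `(φ, ξ, η, ⟨,⟩)` on a Euclidean vector space of dimension
`2n + 1`. -/
structure AlmostContactMetricSpace (n : ℕ) (V : Type*) [NormedAddCommGroup V]
    [InnerProductSpace ℝ V] where
  φ : V →L[ℝ] V
  ξ : V
  η : V →L[ℝ] ℝ
  finrank_eq : Module.finrank ℝ V = 2 * n + 1
  φ_φ : ∀ v, φ (φ v) = -v + η v • ξ
  η_ξ : η ξ = 1
  inner_φ_φ : ∀ v w, ⟪φ v, φ w⟫_ℝ = ⟪v, w⟫_ℝ - η v * η w

/-- The tensor `α(X, Y, Z) = B(Y, Z)(X)`. -/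
def Tensor3.ofBilin {V : Type*} [NormedAddCommGroup V] [InnerProductSpace ℝ V]
    (B : V →L[ℝ] V →L[ℝ] V →L[ℝ] ℝ) : Tensor3 V where
  toFun X := LinearMap.mk₂ ℝ (fun Y Z ↦ B Y Z X)
    (fun Y Y' Z ↦ by rw [map_add]; rfl) (fun c Y Z ↦ by rw [map_smul]; rfl)
    (fun Y Z Z' ↦ by rw [map_add]; rfl) (fun c Y Z ↦ by rw [map_smul]; rfl)
  map_add' X X' := by ext Y Z; exact map_add (B Y Z) X X'
  map_smul' c X := by ext Y Z; exact map_smul (B Y Z) c X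

theorem Tensor3.ofBilin_apply {V : Type*} [NormedAddCommGroup V] [InnerProductSpace ℝ V]
    (B : V →L[ℝ] V →L[ℝ] V →L[ℝ] ℝ) (X Y Z : V) : Tensor3.ofBilin B X Y Z = B Y Z X := rfl

namespace AlmostContactMetricSpace

section Algebra

variable {n : ℕ} {V : Type*} [NormedAddCommGroup V] [InnerProductSpace ℝ V]
  (A : AlmostContactMetricSpace n V)

/-- The fundamental 2-form `Φ(X, Y) = ⟨X, φ Y⟩`. -/
def Φ (X Y : V) : ℝ := ⟪X, A.φ Y⟫_ℝ

/-- The space `C(V)` of tensors with the symmetries of the covariant derivative `∇Φ` of the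
fundamental form with respect to the Levi-Civita connection. -/
def tensorSpace : Submodule ℝ (Tensor3 V) where
  carrier := {α | (∀ X Y Z, α X Y Z = -α X Z Y) ∧
    ∀ X Y Z, α X Y Z =
      -α X (A.φ Y) (A.φ Z) + A.η Y * α X A.ξ Z + A.η Z * α X Y A.ξ}
  zero_mem' := by simp
  add_mem' := by
    rintro α β ⟨h1, h2⟩ ⟨k1, k2⟩
    refine ⟨fun X Y Z ↦ ?_, fun X Y Z ↦ ?_⟩ <;> simp only [LinearMap.add_apply]
    · linear_combination h1 X Y Z + k1 X Y Z
    · linear_combination h2 X Y Z + k2 X Y Z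
  smul_mem' := by
    rintro c α ⟨h1, h2⟩
    refine ⟨fun X Y Z ↦ ?_, fun X Y Z ↦ ?_⟩ <;> simp only [LinearMap.smul_apply, smul_eq_mul]
    · linear_combination c * h1 X Y Z
    · linear_combination c * h2 X Y Z

/-- `(∇_X η)(Y)` expressed through `α = ∇Φ`: it equals `(∇_X Φ)(ξ, φ Y)`. -/
def nablaEta (α : Tensor3 V) (X Y : V) : ℝ := α X A.ξ (A.φ Y)

@[simp] theorem nablaEta_add (α β : Tensor3 V) (X Y : V) :
    A.nablaEta (α + β) X Y = A.nablaEta α X Y + A.nablaEta β X Y := rfl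

@[simp] theorem nablaEta_smul (c : ℝ) (α : Tensor3 V) (X Y : V) :
    A.nablaEta (c • α) X Y = c * A.nablaEta α X Y := rfl

@[simp] theorem nablaEta_zero (X Y : V) : A.nablaEta 0 X Y = 0 := rfl

/-- The class `D₂`. -/
def D2 : Submodule ℝ (Tensor3 V) where
  carrier := {α | α ∈ A.tensorSpace ∧ ∀ X Y Z,
    α X Y Z = A.η X * α A.ξ Y Z + A.η Y * α X A.ξ Z + A.η Z * α X Y A.ξ}
  zero_mem' := ⟨zero_mem _, by simp⟩
  add_mem' := by
    rintro α β ⟨h, h1⟩ ⟨k, k1⟩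
    refine ⟨add_mem h k, fun X Y Z ↦ ?_⟩
    simp only [LinearMap.add_apply]
    linear_combination h1 X Y Z + k1 X Y Z
  smul_mem' := by
    rintro c α ⟨h, h1⟩
    refine ⟨A.tensorSpace.smul_mem c h, fun X Y Z ↦ ?_⟩
    simp only [LinearMap.smul_apply, smul_eq_mul]
    linear_combination c * h1 X Y Z

/-- The class `D₃ = C₁₂`. -/
def D3 : Submodule ℝ (Tensor3 V) where
  carrier := {α | α ∈ A.tensorSpace ∧ ∀ X Y Z,
    α X Y Z = A.η X * A.η Y * α A.ξ A.ξ Z + A.η X * A.η Z * α A.ξ Y A.ξ}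
  zero_mem' := ⟨zero_mem _, by simp⟩
  add_mem' := by
    rintro α β ⟨h, h1⟩ ⟨k, k1⟩
    refine ⟨add_mem h k, fun X Y Z ↦ ?_⟩
    simp only [LinearMap.add_apply]
    linear_combination h1 X Y Z + k1 X Y Z
  smul_mem' := by
    rintro c α ⟨h, h1⟩
    refine ⟨A.tensorSpace.smul_mem c h, fun X Y Z ↦ ?_⟩
    simp only [LinearMap.smul_apply, smul_eq_mul]
    linear_combination c * h1 X Y Z

/-- The class `C₁`: `α(X, X, Y) = 0` and `∇η = 0`. -/
def C1 : Submodule ℝ (Tensor3 V) where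
  carrier := {α | α ∈ A.tensorSpace ∧ (∀ X Y, α X X Y = 0) ∧ ∀ X Y, A.nablaEta α X Y = 0}
  zero_mem' := ⟨zero_mem _, by simp⟩
  add_mem' := by
    rintro α β ⟨h, h1, h2⟩ ⟨k, k1, k2⟩
    exact ⟨add_mem h k, fun X Y ↦ by simp [h1, k1], fun X Y ↦ by simp [h2, k2]⟩
  smul_mem' := by
    rintro c α ⟨h, h1, h2⟩
    exact ⟨A.tensorSpace.smul_mem c h, fun X Y ↦ by simp [h1], fun X Y ↦ by simp [h2]⟩

variable [FiniteDimensional ℝ V]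

/-- The codifferential `δΦ` expressed through `α = ∇Φ`: `δΦ(Z) = -∑ᵢ α(eᵢ, eᵢ, Z)` for an
orthonormal basis `(eᵢ)`. -/
def codiff (α : Tensor3 V) (Z : V) : ℝ :=
  -∑ i, α (stdOrthonormalBasis ℝ V i) (stdOrthonormalBasis ℝ V i) Z

@[simp] theorem codiff_add (α β : Tensor3 V) (Z : V) :
    codiff (α + β) Z = codiff α Z + codiff β Z := by
  simp [codiff, Finset.sum_add_distrib, add_comm]

@[simp] theorem codiff_smul (c : ℝ) (α : Tensor3 V) (Z : V) :
    codiff (c • α) Z = c * codiff α Z := by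
  simp [codiff, Finset.mul_sum]

@[simp] theorem codiff_zero (Z : V) : codiff (0 : Tensor3 V) Z = 0 := by
  simp [codiff]

/-- The class `C₃`: `α(X, Y, Z) = α(φX, φY, Z)` and `δΦ = 0`. -/
def C3 : Submodule ℝ (Tensor3 V) where
  carrier := {α | α ∈ A.tensorSpace ∧ (∀ X Y Z, α X Y Z - α (A.φ X) (A.φ Y) Z = 0) ∧
    ∀ Z, codiff α Z = 0}
  zero_mem' := ⟨zero_mem _, by simp⟩
  add_mem' := by
    rintro α β ⟨h, h1, h2⟩ ⟨k, k1, k2⟩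
    refine ⟨add_mem h k, fun X Y Z ↦ ?_, fun Z ↦ by simp [h2, k2]⟩
    simp only [LinearMap.add_apply]
    linear_combination h1 X Y Z + k1 X Y Z
  smul_mem' := by
    rintro c α ⟨h, h1, h2⟩
    refine ⟨A.tensorSpace.smul_mem c h, fun X Y Z ↦ ?_, fun Z ↦ by simp [h2]⟩
    simp only [LinearMap.smul_apply, smul_eq_mul]
    linear_combination c * h1 X Y Z

/-- The class `C₄`. For `n = 1` the factor `1 / (2 (n - 1))` is `0` by convention, so that
`C₄ = 0`, as it should be in dimension three. -/
def C4 : Submodule ℝ (Tensor3 V) where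
  carrier := {α | α ∈ A.tensorSpace ∧
    (∀ X Y Z, α X Y Z = -(1 / (2 * ((n : ℝ) - 1))) *
      (⟪A.φ X, A.φ Y⟫_ℝ * codiff α Z - ⟪A.φ X, A.φ Z⟫_ℝ * codiff α Y
        - A.Φ X Y * codiff α (A.φ Z) + A.Φ X Z * codiff α (A.φ Y))) ∧
    codiff α A.ξ = 0}
  zero_mem' := ⟨zero_mem _, by simp⟩
  add_mem' := by
    rintro α β ⟨h, h1, h2⟩ ⟨k, k1, k2⟩
    refine ⟨add_mem h k, fun X Y Z ↦ ?_, by simp [h2, k2]⟩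
    simp only [LinearMap.add_apply, codiff_add]
    linear_combination h1 X Y Z + k1 X Y Z
  smul_mem' := by
    rintro c α ⟨h, h1, h2⟩
    refine ⟨A.tensorSpace.smul_mem c h, fun X Y Z ↦ ?_, by simp [h2]⟩
    simp only [LinearMap.smul_apply, smul_eq_mul, codiff_smul]
    linear_combination c * h1 X Y Z

/-- The class `C₆`. -/
def C6 : Submodule ℝ (Tensor3 V) where
  carrier := {α | α ∈ A.tensorSpace ∧
    ∀ X Y Z, α X Y Z = 1 / (2 * (n : ℝ)) *
      (A.η Y * ⟪X, Z⟫_ℝ - A.η Z * ⟪X, Y⟫_ℝ) * codiff α A.ξ}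
  zero_mem' := ⟨zero_mem _, by simp⟩
  add_mem' := by
    rintro α β ⟨h, h1⟩ ⟨k, k1⟩
    refine ⟨add_mem h k, fun X Y Z ↦ ?_⟩
    simp only [LinearMap.add_apply, codiff_add]
    linear_combination h1 X Y Z + k1 X Y Z
  smul_mem' := by
    rintro c α ⟨h, h1⟩
    refine ⟨A.tensorSpace.smul_mem c h, fun X Y Z ↦ ?_⟩
    simp only [LinearMap.smul_apply, smul_eq_mul, codiff_smul]
    linear_combination c * h1 X Y Z

/-- The class `C₇`: `α(X, Y, Z) = η(Z) (∇_Y η)(φX) + η(Y) (∇_{φX} η)(Z)` and `δΦ = 0`. -/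
def C7 : Submodule ℝ (Tensor3 V) where
  carrier := {α | α ∈ A.tensorSpace ∧
    (∀ X Y Z, α X Y Z =
      A.η Z * A.nablaEta α Y (A.φ X) + A.η Y * A.nablaEta α (A.φ X) Z) ∧
    ∀ Z, codiff α Z = 0}
  zero_mem' := ⟨zero_mem _, by simp⟩
  add_mem' := by
    rintro α β ⟨h, h1, h2⟩ ⟨k, k1, k2⟩
    refine ⟨add_mem h k, fun X Y Z ↦ ?_, fun Z ↦ by simp [h2, k2]⟩
    simp only [LinearMap.add_apply, nablaEta_add]
    linear_combination h1 X Y Z + k1 X Y Z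
  smul_mem' := by
    rintro c α ⟨h, h1, h2⟩
    refine ⟨A.tensorSpace.smul_mem c h, fun X Y Z ↦ ?_, fun Z ↦ by simp [h2]⟩
    simp only [LinearMap.smul_apply, smul_eq_mul, nablaEta_smul]
    linear_combination c * h1 X Y Z

/-- The endomorphism `B♯` with `⟨B♯ v, w⟩ = B(v, w)`. -/
def sharp (B : V →ₗ[ℝ] V →ₗ[ℝ] ℝ) : V →ₗ[ℝ] V :=
  letI : CompleteSpace V := FiniteDimensional.complete ℝ V
  (InnerProductSpace.continuousLinearMapOfBilin (𝕜 := ℝ) B.toContinuousBilinearMap : V →L[ℝ] V)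

@[simp] theorem inner_sharp (B : V →ₗ[ℝ] V →ₗ[ℝ] ℝ) (v w : V) : ⟪sharp B v, w⟫_ℝ = B v w :=
  letI : CompleteSpace V := FiniteDimensional.complete ℝ V
  InnerProductSpace.continuousLinearMapOfBilin_apply (𝕜 := ℝ) B.toContinuousBilinearMap v w

@[simp] theorem sharp_add (B C : V →ₗ[ℝ] V →ₗ[ℝ] ℝ) : sharp (B + C) = sharp B + sharp C := by
  ext v
  exact ext_inner_right ℝ fun w ↦ by simp [inner_add_left]

@[simp] theorem sharp_smul (c : ℝ) (B : V →ₗ[ℝ] V →ₗ[ℝ] ℝ) : sharp (c • B) = c • sharp B := by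
  ext v
  exact ext_inner_right ℝ fun w ↦ by simp [inner_smul_left]

/-- The intrinsic endomorphism `S` associated with `α`: `⟨S X, Z⟩ = α(X, ξ, Z)`. -/
def S (α : Tensor3 V) : V →ₗ[ℝ] V := sharp (α.flip A.ξ)

/-- The endomorphism `P` associated with `α`: `⟨P Y, Z⟩ = α(ξ, Y, Z)`. -/
def P (α : Tensor3 V) : V →ₗ[ℝ] V := sharp (α A.ξ)

/-- The intrinsic endomorphism `h` associated with `α`, determined by `P = -2 h + φ S φ + S`. -/
def h (α : Tensor3 V) : V →ₗ[ℝ] V :=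
  (1 / 2 : ℝ) • ((A.φ : V →ₗ[ℝ] V) ∘ₗ A.S α ∘ₗ (A.φ : V →ₗ[ℝ] V) + A.S α - A.P α)

theorem S_add (α β : Tensor3 V) : A.S (α + β) = A.S α + A.S β := by
  simp only [S, ← sharp_add]; rfl

theorem S_smul (c : ℝ) (α : Tensor3 V) : A.S (c • α) = c • A.S α := by
  simp only [S, ← sharp_smul]; rfl

theorem P_add (α β : Tensor3 V) : A.P (α + β) = A.P α + A.P β := by
  simp only [P, ← sharp_add]; rfl

theorem P_smul (c : ℝ) (α : Tensor3 V) : A.P (c • α) = c • A.P α := by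
  simp only [P, ← sharp_smul]; rfl

theorem h_add (α β : Tensor3 V) : A.h (α + β) = A.h α + A.h β := by
  ext v
  simp [h, S_add, P_add]
  module

theorem h_smul (c : ℝ) (α : Tensor3 V) : A.h (c • α) = c • A.h α := by
  ext v
  simp [h, S_smul, P_smul]
  module

/-- The class `C_min = {α ∈ D₂ ⊕ D₃ | h = 2 S}`. -/
def Cmin : Submodule ℝ (Tensor3 V) where
  carrier := {α | α ∈ A.D2 ⊔ A.D3 ∧ A.h α = (2 : ℝ) • A.S α}
  zero_mem' := by
    refine ⟨zero_mem _, ?_⟩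
    have h1 := A.h_smul 0 0
    have h2 := A.S_smul 0 0
    simp only [zero_smul] at h1 h2
    rw [h1, h2, smul_zero]
  add_mem' := by
    rintro α β ⟨h, h1⟩ ⟨k, k1⟩
    exact ⟨add_mem h k, by rw [h_add, S_add, h1, k1, smul_add]⟩
  smul_mem' := by
    rintro c α ⟨h, h1⟩
    exact ⟨Submodule.smul_mem _ c h, by rw [h_smul, S_smul, h1, smul_comm]⟩

end Algebra

end AlmostContactMetricSpace

end

open Bundle Manifold VectorField FiberBundle
open scoped ContDiff Topology

set_option linter.unusedSectionVars false

noncomputable section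

section LC

variable {E : Type*} [NormedAddCommGroup E] [NormedSpace ℝ E]
  {H : Type*} [TopologicalSpace H] {I : ModelWithCorners ℝ E H}
  {M : Type*} [TopologicalSpace M] [ChartedSpace H M]
  [RiemannianBundle (fun x : M ↦ TangentSpace I x)]

variable (I) in
/-- The right-hand side of the Koszul formula, equal to `2 g(∇_X Y, Z)` at `x`. -/
def koszul (Y X Z : Π x : M, TangentSpace I x) (x : M) : ℝ :=
  d% (fun y ↦ ⟪Y y, Z y⟫_ℝ) x (X x) + d% (fun y ↦ ⟪X y, Z y⟫_ℝ) x (Y x)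
    - d% (fun y ↦ ⟪X y, Y y⟫_ℝ) x (Z x)
    + ⟪mlieBracket I X Y x, Z x⟫_ℝ - ⟪mlieBracket I X Z x, Y x⟫_ℝ
    - ⟪mlieBracket I Y Z x, X x⟫_ℝ

variable [IsManifold I ∞ M] [IsContMDiffRiemannianBundle I ∞ E (fun x : M ↦ TangentSpace I x)]

theorem mdiffAt_inner {X Y : Π x : M, TangentSpace I x} {x : M}
    (hX : MDiffAt (T% X) x) (hY : MDiffAt (T% Y) x) : MDiffAt (fun y ↦ ⟪X y, Y y⟫_ℝ) x :=
  MDifferentiableAt.inner_bundle (IB := I) (F := E) (E := fun x : M ↦ TangentSpace I x)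
    (b := fun y ↦ y) hX hY

theorem mvfderiv_inner_add_left {X X' Z : Π x : M, TangentSpace I x} {x : M}
    (hX : MDiffAt (T% X) x) (hX' : MDiffAt (T% X') x) (hZ : MDiffAt (T% Z) x) :
    d% (fun y ↦ ⟪(X + X') y, Z y⟫_ℝ) x =
      d% (fun y ↦ ⟪X y, Z y⟫_ℝ) x + d% (fun y ↦ ⟪X' y, Z y⟫_ℝ) x := by
  rw [← mvfderiv_add (mdiffAt_inner hX hZ) (mdiffAt_inner hX' hZ)]
  congr 1; ext y; simp [inner_add_left]

theorem mvfderiv_inner_smul_left {f : M → ℝ} {X Z : Π x : M, TangentSpace I x} {x : M}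
    (hf : MDiffAt f x) (hX : MDiffAt (T% X) x) (hZ : MDiffAt (T% Z) x) :
    d% (fun y ↦ ⟪(f • X) y, Z y⟫_ℝ) x =
      f x • d% (fun y ↦ ⟪X y, Z y⟫_ℝ) x + ⟪X x, Z x⟫_ℝ • d% f x := by
  rw [← mvfderiv_mul hf (mdiffAt_inner hX hZ)]
  congr 1; ext y; simp [inner_smul_left]

theorem mvfderiv_inner_comm (X Z : Π x : M, TangentSpace I x) (x : M) :
    d% (fun y ↦ ⟪X y, Z y⟫_ℝ) x = d% (fun y ↦ ⟪Z y, X y⟫_ℝ) x := by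
  congr 1; ext y; exact real_inner_comm _ _

theorem mvfderiv_inner_add_right {X X' Z : Π x : M, TangentSpace I x} {x : M}
    (hX : MDiffAt (T% X) x) (hX' : MDiffAt (T% X') x) (hZ : MDiffAt (T% Z) x) :
    d% (fun y ↦ ⟪Z y, (X + X') y⟫_ℝ) x =
      d% (fun y ↦ ⟪Z y, X y⟫_ℝ) x + d% (fun y ↦ ⟪Z y, X' y⟫_ℝ) x := by
  rw [mvfderiv_inner_comm, mvfderiv_inner_add_left hX hX' hZ, mvfderiv_inner_comm X,
    mvfderiv_inner_comm X']

theorem mvfderiv_inner_smul_right {f : M → ℝ} {X Z : Π x : M, TangentSpace I x} {x : M}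
    (hf : MDiffAt f x) (hX : MDiffAt (T% X) x) (hZ : MDiffAt (T% Z) x) :
    d% (fun y ↦ ⟪Z y, (f • X) y⟫_ℝ) x =
      f x • d% (fun y ↦ ⟪Z y, X y⟫_ℝ) x + ⟪Z x, X x⟫_ℝ • d% f x := by
  rw [mvfderiv_inner_comm, mvfderiv_inner_smul_left hf hX hZ, mvfderiv_inner_comm X,
    real_inner_comm]

variable [FiniteDimensional ℝ E]

theorem koszul_tensorial_left {Y Z : Π x : M, TangentSpace I x} {x : M}
    (hY : MDiffAt (T% Y) x) (hZ : MDiffAt (T% Z) x) :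
    TensorialAt I E (fun X ↦ koszul I Y X Z x) x where
  smul hf hX := by
    simp only [koszul, mvfderiv_inner_smul_left hf hX hZ, mvfderiv_inner_smul_left hf hX hY,
      mlieBracket_smul_left hf hX]
    simp [inner_add_left, inner_smul_left, inner_smul_right]
    ring
  add hX hX' := by
    simp only [koszul, mvfderiv_inner_add_left hX hX' hZ, mvfderiv_inner_add_left hX hX' hY,
      mlieBracket_add_left hX hX']
    simp [inner_add_left, inner_add_right]
    ring

theorem koszul_tensorial_right {Y X : Π x : M, TangentSpace I x} {x : M}
    (hY : MDiffAt (T% Y) x) (hX : MDiffAt (T% X) x) :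
    TensorialAt I E (fun Z ↦ koszul I Y X Z x) x where
  smul hf hZ := by
    simp only [koszul, mvfderiv_inner_smul_right hf hZ hX, mvfderiv_inner_smul_right hf hZ hY,
      mlieBracket_smul_right hf hZ]
    simp [inner_add_left, inner_smul_left, inner_smul_right, real_inner_comm]
    ring
  add hZ hZ' := by
    simp only [koszul, mvfderiv_inner_add_right hZ hZ' hX, mvfderiv_inner_add_right hZ hZ' hY,
      mlieBracket_add_right hZ hZ']
    simp [inner_add_left, inner_add_right]
    ring

instance instFiniteDimensionalTangentSpace (x : M) : FiniteDimensional ℝ (TangentSpace I x) :=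
  inferInstanceAs (FiniteDimensional ℝ E)

instance instCompleteSpaceTangentSpace (x : M) : CompleteSpace (TangentSpace I x) :=
  FiniteDimensional.complete ℝ _

open scoped Classical in
variable (I) in
/-- The Levi-Civita derivative `∇ Y` at `x`, obtained from the Koszul formula (and `0` where the
field `Y` is not differentiable). -/
def leviCivitaFun (Y : Π x : M, TangentSpace I x) (x : M) :
    TangentSpace I x →L[ℝ] TangentSpace I x :=
  if hY : MDiffAt (T% Y) x then
    (1 / 2 : ℝ) • InnerProductSpace.continuousLinearMapOfBilin (𝕜 := ℝ)
      (TensorialAt.mkHom₂ (fun X Z ↦ koszul I Y X Z x) x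
        (fun _ hZ ↦ koszul_tensorial_left hY hZ) (fun _ hX ↦ koszul_tensorial_right hY hX))
  else 0

theorem inner_leviCivitaFun {X Y Z : Π x : M, TangentSpace I x} {x : M}
    (hX : MDiffAt (T% X) x) (hY : MDiffAt (T% Y) x) (hZ : MDiffAt (T% Z) x) :
    ⟪leviCivitaFun I Y x (X x), Z x⟫_ℝ = 1 / 2 * koszul I Y X Z x := by
  rw [leviCivitaFun, dif_pos hY, smul_apply, inner_smul_left,
    InnerProductSpace.continuousLinearMapOfBilin_apply, TensorialAt.mkHom₂_apply _ _ hX hZ]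
  simp

/-- Endomorphisms of a tangent space agree if their matrix coefficients agree on values of
differentiable vector fields. -/
theorem endo_ext_of_inner {x : M} {A B : TangentSpace I x →L[ℝ] TangentSpace I x}
    (h : ∀ X Z : Π x : M, TangentSpace I x, MDiffAt (T% X) x → MDiffAt (T% Z) x →
      ⟪A (X x), Z x⟫_ℝ = ⟪B (X x), Z x⟫_ℝ) : A = B := by
  ext v
  refine ext_inner_right ℝ fun w ↦ ?_
  simpa using h (extend E v) (extend E w) (mdifferentiableAt_extend ..)
    (mdifferentiableAt_extend ..)

variable (I M) in
/-- The Levi-Civita connection `∇^g` of the Riemannian metric `g` on `M`. -/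
def leviCivita : CovariantDerivative I E (TangentSpace I : M → Type _) where
  toFun := leviCivitaFun I
  isCovariantDerivativeOnUniv :=
    { add := by
        intro Y Y' x hY hY' _
        refine endo_ext_of_inner fun X Z hX hZ ↦ ?_
        rw [inner_leviCivitaFun hX (mdifferentiableAt_add_section hY hY') hZ,
          add_apply, inner_add_left, inner_leviCivitaFun hX hY hZ,
          inner_leviCivitaFun hX hY' hZ]
        simp only [koszul, mvfderiv_inner_add_left hY hY' hZ, mvfderiv_inner_add_right hY hY' hX,
          mlieBracket_add_left hY hY', mlieBracket_add_right hY hY']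
        simp [inner_add_left, inner_add_right]
        ring
      leibniz := by
        intro Y f x hY hf _
        refine endo_ext_of_inner fun X Z hX hZ ↦ ?_
        rw [inner_leviCivitaFun hX (hf.smul_section hY) hZ,
          add_apply, inner_add_left, smul_apply,
          inner_smul_left, inner_leviCivitaFun hX hY hZ]
        simp only [koszul, mvfderiv_inner_smul_left hf hY hZ, mvfderiv_inner_smul_right hf hY hX,
          mlieBracket_smul_left hf hY, mlieBracket_smul_right hf hY]
        simp [inner_add_left, inner_smul_left, inner_smul_right, real_inner_comm]
        ring }

/-- The Levi-Civita connection is torsion free. -/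
theorem leviCivita_torsion : (leviCivita I M).torsion = 0 := by
  rw [CovariantDerivative.torsion_eq_zero_iff]
  intro X Y x hX hY
  refine ext_inner_right ℝ fun w ↦ ?_
  have hw : MDiffAt (T% (extend E w : Π y : M, TangentSpace I y)) x :=
    mdifferentiableAt_extend ..
  have h1 := inner_leviCivitaFun hX hY hw
  have h2 := inner_leviCivitaFun hY hX hw
  have h3 : mlieBracket I Y X x = - mlieBracket I X Y x := by rw [mlieBracket_swap]; rfl
  simp only [extend_apply_self, koszul, h3, inner_neg_left, mvfderiv_inner_comm Y X] at h1 h2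
  change ⟪leviCivitaFun I Y x (X x) - leviCivitaFun I X x (Y x), w⟫_ℝ = _
  rw [inner_sub_left, h1, h2]
  ring

/-- The Levi-Civita connection is metric. -/
theorem leviCivita_metric :
    CovariantDerivative.IsMetricCompatible (V := fun x : M ↦ TangentSpace I x)
      (leviCivita I M) := by
  rw [CovariantDerivative.isMetricCompatible_iff]
  intro x X Y Z hX hY hZ
  change d% (fun y ↦ ⟪Y y, Z y⟫_ℝ) x (X x) =
    ⟪leviCivitaFun I Y x (X x), Z x⟫_ℝ + ⟪Y x, leviCivitaFun I Z x (X x)⟫_ℝ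
  have h3 : mlieBracket I Z Y x = - mlieBracket I Y Z x := by rw [mlieBracket_swap]; rfl
  rw [real_inner_comm _ (Y x), inner_leviCivitaFun hX hY hZ, inner_leviCivitaFun hX hZ hY]
  simp only [koszul, h3, inner_neg_left, mvfderiv_inner_comm Z Y]
  ring

end LC

section AlmostContact

variable {n : ℕ} {E : Type*} [NormedAddCommGroup E] [NormedSpace ℝ E] [FiniteDimensional ℝ E]
  {H : Type*} [TopologicalSpace H] {I : ModelWithCorners ℝ E H}
  {M : Type*} [TopologicalSpace M] [ChartedSpace H M] [IsManifold I ∞ M]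
  [RiemannianBundle (fun x : M ↦ TangentSpace I x)]
  [IsContMDiffRiemannianBundle I ∞ E (fun x : M ↦ TangentSpace I x)]

variable (n I M) in
/-- A smooth almost contact metric structure `(φ, ξ, η, g)` on a `(2n+1)`-dimensional Riemannian
manifold `(M, g)`. -/
structure AlmostContactMetricStructure where
  /-- The structure on each tangent space. -/
  fiber : ∀ x : M, AlmostContactMetricSpace n (TangentSpace I x)
  contMDiff_φ : ContMDiff I (I.prod 𝓘(ℝ, E →L[ℝ] E)) ∞
    (fun x ↦ TotalSpace.mk' (E →L[ℝ] E)
      (E := fun x : M ↦ TangentSpace I x →L[ℝ] TangentSpace I x) x (fiber x).φ)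
  contMDiff_ξ : ContMDiff I (I.prod 𝓘(ℝ, E)) ∞
    (fun x ↦ TotalSpace.mk' E (E := fun x : M ↦ TangentSpace I x) x (fiber x).ξ)
  contMDiff_η : ContMDiff I (I.prod 𝓘(ℝ, E →L[ℝ] ℝ)) ∞
    (fun x ↦ TotalSpace.mk' (E →L[ℝ] ℝ)
      (E := fun x : M ↦ TangentSpace I x →L[ℝ] ℝ) x (fiber x).η)

namespace AlmostContactMetricStructure

variable (A : AlmostContactMetricStructure n I M)

theorem mdiffAt_φ {Y : Π x : M, TangentSpace I x} {x : M} (hY : MDiffAt (T% Y) x) :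
    MDiffAt (T% (fun y ↦ (A.fiber y).φ (Y y))) x :=
  MDifferentiableAt.clm_bundle_apply (F₁ := E) (F₂ := E) (E₁ := fun x : M ↦ TangentSpace I x)
    (E₂ := fun x : M ↦ TangentSpace I x) (b := fun y ↦ y)
    (A.contMDiff_φ.mdifferentiableAt (by simp)) hY

/-- `(∇^g_X Φ)(Y, Z) = X(Φ(Y, Z)) - Φ(∇^g_X Y, Z) - Φ(Y, ∇^g_X Z)` at `x` for vector fields
`Y` and `Z`, as a linear form in `X`. -/
def nablaΦAux (Y Z : Π x : M, TangentSpace I x) (x : M) : TangentSpace I x →L[ℝ] ℝ :=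
  LinearMap.toContinuousLinearMap
  { toFun := fun v ↦ d% (fun y ↦ (A.fiber y).Φ (Y y) (Z y)) x v
      - (A.fiber x).Φ (leviCivita I M Y x v) (Z x) - (A.fiber x).Φ (Y x) (leviCivita I M Z x v)
    map_add' := fun v w ↦ by
      simp [AlmostContactMetricSpace.Φ, inner_add_left, inner_add_right]
      ring
    map_smul' := fun c v ↦ by
      simp [AlmostContactMetricSpace.Φ, inner_smul_left, inner_smul_right]
      ring }

theorem nablaΦAux_tensorial_left {Z : Π x : M, TangentSpace I x} {x : M}
    (hZ : MDiffAt (T% Z) x) : TensorialAt I E (fun Y ↦ A.nablaΦAux Y Z x) x where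
  smul {f Y} hf hY := by
    ext v
    have h := (leviCivita I M).isCovariantDerivativeOnUniv.leibniz hY hf
    simp only [nablaΦAux, AlmostContactMetricSpace.Φ, h,
      mvfderiv_inner_smul_left hf hY (A.mdiffAt_φ hZ)]
    simp [inner_add_left, inner_smul_left]
    ring
  add {Y Y'} hY hY' := by
    ext v
    have h := (leviCivita I M).isCovariantDerivativeOnUniv.add hY hY'
    simp only [nablaΦAux, AlmostContactMetricSpace.Φ, h,
      mvfderiv_inner_add_left hY hY' (A.mdiffAt_φ hZ)]
    simp [inner_add_left]
    ring

theorem nablaΦAux_tensorial_right {Y : Π x : M, TangentSpace I x} {x : M}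
    (hY : MDiffAt (T% Y) x) : TensorialAt I E (fun Z ↦ A.nablaΦAux Y Z x) x where
  smul {f Z} hf hZ := by
    ext v
    have h := (leviCivita I M).isCovariantDerivativeOnUniv.leibniz hZ hf
    have h2 := mvfderiv_inner_smul_right hf (A.mdiffAt_φ hZ) hY
    have h3 : (fun y ↦ ⟪Y y, (A.fiber y).φ ((f • Z) y)⟫_ℝ) =
        fun y ↦ ⟪Y y, (f • fun y ↦ (A.fiber y).φ (Z y)) y⟫_ℝ := by
      ext y; simp
    simp only [nablaΦAux, AlmostContactMetricSpace.Φ, h, h3, h2]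
    simp [inner_add_right, inner_smul_right]
    ring
  add {Z Z'} hZ hZ' := by
    ext v
    have h := (leviCivita I M).isCovariantDerivativeOnUniv.add hZ hZ'
    have h2 := mvfderiv_inner_add_right (A.mdiffAt_φ hZ) (A.mdiffAt_φ hZ') hY
    have h3 : (fun y ↦ ⟪Y y, (A.fiber y).φ ((Z + Z') y)⟫_ℝ) =
        fun y ↦ ⟪Y y, ((fun y ↦ (A.fiber y).φ (Z y)) + fun y ↦ (A.fiber y).φ (Z' y)) y⟫_ℝ := by
      ext y; simp
    simp only [nablaΦAux, AlmostContactMetricSpace.Φ, h, h3, h2]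
    simp [inner_add_right]
    ring

/-- The tensor `(X, Y, Z) ↦ (∇^g_X Φ)(Y, Z)` at the point `x`. -/
def nablaΦ (x : M) : Tensor3 (TangentSpace I x) :=
  Tensor3.ofBilin (TensorialAt.mkHom₂ (fun Y Z ↦ A.nablaΦAux Y Z x) x
    (fun _ hZ ↦ A.nablaΦAux_tensorial_left hZ) (fun _ hY ↦ A.nablaΦAux_tensorial_right hY))

theorem nablaΦ_apply {X Y Z : Π x : M, TangentSpace I x} {x : M}
    (hY : MDiffAt (T% Y) x) (hZ : MDiffAt (T% Z) x) :
    A.nablaΦ x (X x) (Y x) (Z x) =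
      d% (fun y ↦ (A.fiber y).Φ (Y y) (Z y)) x (X x)
        - (A.fiber x).Φ (leviCivita I M Y x (X x)) (Z x)
        - (A.fiber x).Φ (Y x) (leviCivita I M Z x (X x)) := by
  rw [nablaΦ, Tensor3.ofBilin_apply, TensorialAt.mkHom₂_apply _ _ hY hZ]
  rfl

/-- The manifold is of class `U`, where `U x` is a space of `(0,3)`-tensors on `T_x M`. -/
def IsOfClass (U : ∀ x : M, Submodule ℝ (Tensor3 (TangentSpace I x))) : Prop :=
  ∀ x, A.nablaΦ x ∈ U x

/-- The structure is `H`-parallel: `(∇^g_X Φ)(Y, Z) = 0` for all horizontal `X, Y, Z`. -/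
def IsHParallel : Prop :=
  ∀ (x : M) (X Y Z : TangentSpace I x), (A.fiber x).η X = 0 → (A.fiber x).η Y = 0 →
    (A.fiber x).η Z = 0 → A.nablaΦ x X Y Z = 0

/-- The exterior derivative `dη(X, Y) = X(η(Y)) - Y(η(X)) - η([X, Y])` on vector fields. -/
def dη (X Y : Π x : M, TangentSpace I x) (x : M) : ℝ :=
  d% (fun y ↦ (A.fiber y).η (Y y)) x (X x) - d% (fun y ↦ (A.fiber y).η (X y)) x (Y x)
    - (A.fiber x).η (mlieBracket I X Y x)

/-- The 3-form `η ∧ dη` on vector fields, the cyclic sum of `η(X) dη(Y, Z)`. -/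
def etaWedgeDEta (X Y Z : Π x : M, TangentSpace I x) (x : M) : ℝ :=
  (A.fiber x).η (X x) * A.dη Y Z x + (A.fiber x).η (Y x) * A.dη Z X x
    + (A.fiber x).η (Z x) * A.dη X Y x

/-- The torsion `T` of the connection, as the `(0,3)`-tensor `(X, Y, Z) ↦ g(T(X, Y), Z)`, is given
on vector fields by `τ`. -/
def TorsionEq (conn : CovariantDerivative I E (TangentSpace I : M → Type _))
    (τ : (Π x : M, TangentSpace I x) → (Π x : M, TangentSpace I x) →
      (Π x : M, TangentSpace I x) → M → ℝ) : Prop :=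
  ∀ (x : M) (X Y Z : Π x : M, TangentSpace I x),
    MDiffAt (T% X) x → MDiffAt (T% Y) x → MDiffAt (T% Z) x →
      ⟪conn.torsion x (X x) (Y x), Z x⟫_ℝ = τ X Y Z x

/-- A characteristic connection: a smooth connection on `TM` that parallelizes `g, φ, ξ, η` and
whose torsion `(X, Y, Z) ↦ g(T(X, Y), Z)` is totally skew-symmetric. -/
structure IsCharacteristicConnection
    (conn : CovariantDerivative I E (TangentSpace I : M → Type _)) : Prop where
  smooth : CovariantDerivative.ContMDiffCovariantDerivative conn ∞
  parallel_g : CovariantDerivative.IsMetricCompatible (V := fun x : M ↦ TangentSpace I x) conn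
  parallel_φ : ∀ (x : M) (Y : Π x : M, TangentSpace I x), MDiffAt (T% Y) x →
    ∀ v, conn (fun y ↦ (A.fiber y).φ (Y y)) x v = (A.fiber x).φ (conn Y x v)
  parallel_ξ : ∀ (x : M) v, conn (fun y ↦ (A.fiber y).ξ) x v = 0
  parallel_η : ∀ (x : M) (Y : Π x : M, TangentSpace I x), MDiffAt (T% Y) x →
    ∀ v, d% (fun y ↦ (A.fiber y).η (Y y)) x v = (A.fiber x).η (conn Y x v)
  skew_torsion : ∀ (x : M) (u v w : TangentSpace I x),
    ⟪conn.torsion x u v, w⟫_ℝ = -⟪conn.torsion x u w, v⟫_ℝ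

/-- The manifold admits a characteristic connection. -/
def AdmitsCharacteristicConnection : Prop :=
  ∃ conn : CovariantDerivative I E (TangentSpace I : M → Type _),
    A.IsCharacteristicConnection conn

end AlmostContactMetricStructure

end AlmostContact

end

/-! A metric connection with totally skew torsion `T` is necessarily `∇^g + T/2`: its difference
from `∇^g` is skew by metricity and is then determined by the torsion
(`IsCharacteristicConnection.inner_eq`). For it, `∇φ = 0` is the pointwise linear condition
`IsCharTorsion` relating `α = ∇^g Φ` to `T`. Conversely, a 3-form satisfying that condition makes
`∇^g + T/2` parallelize everything: `g` by skewness, `φ` by the condition, `ξ` because `φ(∇ξ) = 0`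
and `|ξ| = 1`, and `η` by duality. The 3-form is unique and given by the explicit formula
`charTorsion`, so pointwise solutions fit together into a smooth tensor. Thus a characteristic
connection exists iff `α` lies in `charSpace` at every point.

What remains is algebra: `charSpace_eq_sup`. Each listed class lies in `charSpace` because one can
write its 3-form down. For the reverse inclusion, split `T` into a horizontal part and `η ∧ ω` with
`ω = T(ξ, ·, ·)`. In the horizontal part, the complex types (3,0)+(0,3) give `C₁`, and the types
(2,1)+(1,2) give `C₃ ⊕ C₄`, separated by the trace `δΦ`. In `η ∧ ω`, the `φ`-invariant part of `ω`
gives `C₆ ⊕ C₇`, again separated by a trace, and the anti-invariant part gives `C_min`.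

If the manifold is `H`-parallel, the horizontal part of `α` vanishes, hence so does that of `T`.
Only the last three classes survive, and `T = η ∧ ω` with `ω = dη`, because `η` is parallel. -/

noncomputable section

/-- A `(0,3)`-tensor built from a function that is linear in each argument. -/
def Tensor3.ofFun {V : Type*} [NormedAddCommGroup V] [InnerProductSpace ℝ V] (f : V → V → V → ℝ)
    (add₁ : ∀ X X' Y Z, f (X + X') Y Z = f X Y Z + f X' Y Z := by
      intros; simp only [map_add, LinearMap.add_apply, inner_add_left]; ring)
    (smul₁ : ∀ (c : ℝ) X Y Z, f (c • X) Y Z = c * f X Y Z := by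
      intros; simp only [map_smul, LinearMap.smul_apply, smul_eq_mul, real_inner_smul_left]; ring)
    (add₂ : ∀ X Y Y' Z, f X (Y + Y') Z = f X Y Z + f X Y' Z := by
      intros; simp only [map_add, LinearMap.add_apply, inner_add_right]; ring)
    (smul₂ : ∀ (c : ℝ) X Y Z, f X (c • Y) Z = c * f X Y Z := by
      intros; simp only [map_smul, LinearMap.smul_apply, smul_eq_mul, real_inner_smul_right]; ring)
    (add₃ : ∀ X Y Z Z', f X Y (Z + Z') = f X Y Z + f X Y Z' := by
      intros; simp only [map_add, LinearMap.add_apply, inner_add_right]; ring)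
    (smul₃ : ∀ (c : ℝ) X Y Z, f X Y (c • Z) = c * f X Y Z := by
      intros; simp only [map_smul, LinearMap.smul_apply, smul_eq_mul, real_inner_smul_right]; ring) :
    Tensor3 V where
  toFun X := LinearMap.mk₂ ℝ (f X) (add₂ X) (fun c Y Z ↦ smul₂ c X Y Z) (add₃ X)
    (fun c Y Z ↦ smul₃ c X Y Z)
  map_add' X X' := by ext Y Z; exact add₁ X X' Y Z
  map_smul' c X := by ext Y Z; exact smul₁ c X Y Z

@[simp] theorem Tensor3.ofFun_apply {V : Type*} [NormedAddCommGroup V] [InnerProductSpace ℝ V]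
    (f : V → V → V → ℝ) (a₁ s₁ a₂ s₂ a₃ s₃) (X Y Z : V) :
    Tensor3.ofFun f a₁ s₁ a₂ s₂ a₃ s₃ X Y Z = f X Y Z := rfl

/-! ### Linear algebra: every listed class comes from 3-forms. -/

namespace AlmostContactMetricSpace

variable {n : ℕ} {V : Type*} [NormedAddCommGroup V] [InnerProductSpace ℝ V]
  (A : AlmostContactMetricSpace n V)

@[simp] theorem φ_ξ : A.φ A.ξ = 0 := by
  have h0 : A.φ (A.φ A.ξ) = 0 := by rw [A.φ_φ, A.η_ξ, one_smul, neg_add_cancel]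
  have h1 : A.φ A.ξ = A.η (A.φ A.ξ) • A.ξ := by
    have := A.φ_φ (A.φ A.ξ)
    rw [h0, map_zero] at this
    exact (neg_add_eq_zero.mp this.symm)
  have h2 : (A.η (A.φ A.ξ) * A.η (A.φ A.ξ)) • A.ξ = 0 := by
    rw [mul_smul, ← h1, ← map_smul, ← h1, h0]
  have h3 : A.ξ ≠ 0 := fun h ↦ by simpa [h] using A.η_ξ
  rw [h1]
  rcases smul_eq_zero.mp h2 with h | h
  · rw [mul_self_eq_zero.mp h, zero_smul]
  · exact absurd h h3

@[simp] theorem η_φ (v : V) : A.η (A.φ v) = 0 := by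
  have h1 := A.φ_φ (A.φ v)
  rw [A.φ_φ v, map_add, map_neg, map_smul, φ_ξ, smul_zero, add_zero] at h1
  have h2 : A.η (A.φ v) • A.ξ = 0 := by
    rw [← add_eq_left (a := -A.φ v)]; exact h1.symm
  have := congrArg A.η h2
  simpa [A.η_ξ] using this

theorem inner_ξ (v : V) : ⟪v, A.ξ⟫_ℝ = A.η v := by
  have := A.inner_φ_φ v A.ξ
  rw [φ_ξ, inner_zero_right, A.η_ξ] at this
  linarith

theorem inner_φ_left (v w : V) : ⟪A.φ v, w⟫_ℝ = -⟪v, A.φ w⟫_ℝ := by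
  have := A.inner_φ_φ (A.φ v) w
  rw [A.φ_φ, inner_add_left, inner_neg_left, inner_smul_left, real_inner_comm (A.φ w) A.ξ,
    inner_ξ, η_φ, η_φ] at this
  linarith

/-- A `(0,3)`-tensor is a 3-form. -/
def IsThreeForm (T : Tensor3 V) : Prop :=
  (∀ X Y Z, T X Y Z = -T Y X Z) ∧ ∀ X Y Z, T X Y Z = -T X Z Y

/-- The tensor `α` is the covariant derivative of `Φ` with respect to the Levi-Civita connection
as prescribed by a characteristic connection with torsion `T`. -/
def IsCharTorsion (α T : Tensor3 V) : Prop :=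
  ∀ X Y Z, α X Y Z = 1 / 2 * (T X Y (A.φ Z) + T X (A.φ Y) Z)

/-- The tensors arising as `∇^g Φ` in presence of a characteristic connection. -/
def charSpace : Submodule ℝ (Tensor3 V) where
  carrier := {α | ∃ T, IsThreeForm T ∧ A.IsCharTorsion α T}
  zero_mem' := ⟨0, by simp [IsThreeForm], by simp [IsCharTorsion]⟩
  add_mem' := by
    rintro α β ⟨T, ⟨h1, h2⟩, h3⟩ ⟨U, ⟨k1, k2⟩, k3⟩
    refine ⟨T + U, ⟨fun X Y Z ↦ ?_, fun X Y Z ↦ ?_⟩, fun X Y Z ↦ ?_⟩ <;>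
      simp only [LinearMap.add_apply]
    · linear_combination h1 X Y Z + k1 X Y Z
    · linear_combination h2 X Y Z + k2 X Y Z
    · linear_combination h3 X Y Z + k3 X Y Z
  smul_mem' := by
    rintro c α ⟨T, ⟨h1, h2⟩, h3⟩
    refine ⟨c • T, ⟨fun X Y Z ↦ ?_, fun X Y Z ↦ ?_⟩, fun X Y Z ↦ ?_⟩ <;>
      simp only [LinearMap.smul_apply, smul_eq_mul]
    · linear_combination c * h1 X Y Z
    · linear_combination c * h2 X Y Z
    · linear_combination c * h3 X Y Z

variable {A}

theorem IsThreeForm.cyc {T : Tensor3 V} (hT : IsThreeForm T) (X Y Z : V) :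
    T X Y Z = T Y Z X := by
  rw [hT.1, hT.2, neg_neg]

/-- A Koszul-type inversion: in the alternating sum of three cyclic copies of the defining relation,
all terms cancel except the two equal to `T(X, Y, φZ)`. It shows that `α` determines `T` as soon as
one argument lies in the image of `φ`, and it dictates the witnesses used for the individual
classes. -/
theorem IsCharTorsion.apply_φ {α T : Tensor3 V} (h : A.IsCharTorsion α T) (hT : IsThreeForm T)
    (X Y Z : V) : T X Y (A.φ Z) = α X Y Z + α Y Z X - α Z X Y := by
  rw [h, h, h, hT.cyc Y, hT.cyc Z, ← hT.cyc X Y (A.φ Z)]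
  linear_combination (1 / 2 : ℝ) * hT.cyc Z X (A.φ Y)

theorem tensorSpace_apply_ξ_ξ {α : Tensor3 V} (h : α ∈ A.tensorSpace) (X : V) :
    α X A.ξ A.ξ = 0 := by
  have := h.1 X A.ξ A.ξ
  linarith

theorem tensorSpace_apply_φ_φ {α : Tensor3 V} (h : α ∈ A.tensorSpace) (X Y Z : V) :
    α X (A.φ Y) (A.φ Z) = -α X Y Z + A.η Y * α X A.ξ Z + A.η Z * α X Y A.ξ := by
  have := h.2 X Y Z
  linarith

theorem C1_le_charSpace : A.C1 ≤ A.charSpace := by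
  rintro α ⟨h, h1, h2⟩
  have e1 : ∀ X Z, α X A.ξ Z = 0 := fun X Z ↦ by
    have h3 := h2 X (A.φ Z)
    have h4 := tensorSpace_apply_ξ_ξ h X
    simp only [nablaEta, A.φ_φ, map_add, map_neg, map_smul, h4, smul_zero] at h3
    linarith
  have e2 : ∀ X Y, α X Y A.ξ = 0 := fun X Y ↦ by rw [h.1, e1, neg_zero]
  have e3 : ∀ X Y Z, α X Y Z = -α Y X Z := fun X Y Z ↦ by
    have := h1 (X + Y) Z
    simp only [map_add, LinearMap.add_apply, h1] at this
    linarith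
  have e4 : ∀ X Y Z, α X Y (A.φ Z) = α X (A.φ Y) Z := fun X Y Z ↦ by
    have := tensorSpace_apply_φ_φ h X Y (A.φ Z)
    simp only [A.φ_φ, map_add, map_neg, map_smul, e1, e2, smul_eq_mul] at this
    linarith
  -- Here `α` is itself a 3-form, so `IsCharTorsion.apply_φ` would read `T(X, Y, φZ) = α(X, Y, Z)`;
  -- replacing `Z` by `φZ` gives the witness. It is skew because `φ` can be moved between the last
  -- two slots.
  refine ⟨.ofFun fun X Y Z ↦ -α X Y (A.φ Z), ⟨fun X Y Z ↦ ?_, fun X Y Z ↦ ?_⟩, fun X Y Z ↦ ?_⟩ <;>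
    simp only [Tensor3.ofFun_apply]
  · rw [e3]
  · rw [e4, h.1]
  · rw [← e4]
    simp only [A.φ_φ, map_add, map_neg, map_smul, e2, smul_zero]
    ring

/-- The tensors satisfying the defining symmetry of `C₃`, which is shared by `C₄`, come from
3-forms. -/
theorem mem_charSpace_of_φ_φ {α : Tensor3 V} (h : α ∈ A.tensorSpace)
    (h1 : ∀ X Y Z, α X Y Z - α (A.φ X) (A.φ Y) Z = 0) : α ∈ A.charSpace := by
  have e0 : ∀ Y Z, α A.ξ Y Z = 0 := fun Y Z ↦ by simpa using h1 A.ξ Y Z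
  have e1 : ∀ X Z, α X A.ξ Z = 0 := fun X Z ↦ by simpa using h1 X A.ξ Z
  have e2 : ∀ X Y, α X Y A.ξ = 0 := fun X Y ↦ by rw [h.1, e1, neg_zero]
  have e4 : ∀ X Y Z, α X (A.φ Y) Z = α X Y (A.φ Z) := fun X Y Z ↦ by
    have := tensorSpace_apply_φ_φ h X Y (A.φ Z)
    simp only [A.φ_φ, map_add, map_neg, map_smul, e1, e2, smul_eq_mul] at this
    linarith
  have e5 : ∀ X Y Z, α (A.φ X) Y Z = -α X Y (A.φ Z) := fun X Y Z ↦ by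
    have := h1 (A.φ X) Y Z
    simp only [A.φ_φ, map_add, map_neg, map_smul, e0, e4, smul_zero, LinearMap.add_apply,
      LinearMap.neg_apply, LinearMap.smul_apply] at this
    linarith
  -- Since `α` vanishes when any argument is `ξ`, a horizontal `T` is sought;
  -- `IsCharTorsion.apply_φ` at `φZ` then forces this formula, the sign coming from `φ² = -1` on
  -- `H`.
  refine ⟨.ofFun fun X Y Z ↦ -(α X Y (A.φ Z) + α Y (A.φ Z) X - α (A.φ Z) X Y),
    ⟨fun X Y Z ↦ ?_, fun X Y Z ↦ ?_⟩, fun X Y Z ↦ ?_⟩ <;>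
    simp only [Tensor3.ofFun_apply]
  · rw [h.1 Y, h.1 _ Y X, h.1 X]; ring
  · simp only [e4, e5]
    linarith [h.1 X Z (A.φ Y), h.1 Z X (A.φ Y), e4 X Y Z, e4 Y X Z, e4 Z X Y, h.1 Z Y (A.φ X), h.1 Y Z (A.φ X),
      h.1 X Y (A.φ Z), h.1 X (A.φ Y) Z, e4 Z Y X, e4 Y Z X, e4 X Z Y]
  · simp only [e4, e5, A.φ_φ, map_add, map_neg, map_smul, e0, e1, e2, smul_zero,
      LinearMap.add_apply, LinearMap.neg_apply, LinearMap.smul_apply]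
    linarith [h.1 X Y Z, h.1 Y X Z, h.1 Z X Y]

/-- Tensors built from a bilinear form `B` with `B(X, φ Z)` skew-symmetric come from 3-forms. -/
theorem mem_charSpace_of_bilin {α : Tensor3 V} (B : V →ₗ[ℝ] V →ₗ[ℝ] ℝ)
    (hB' : ∀ X, B X A.ξ = 0)
    (hB : ∀ X Z, B X (A.φ Z) = -B Z (A.φ X))
    (h : ∀ X Y Z, α X Y Z = A.η X * (B Z Y - B Y Z) + A.η Y * B X Z - A.η Z * B X Y) :
    α ∈ A.charSpace := by
  -- The hypotheses give `α(X, ξ, Z) = B(X, Z)`, while the required relation makes it `T(X, ξ, φZ) /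
  -- 2`. Hence `T(ξ, X, φZ) = -2 B(X, Z)`, which explains the factor `-2`; the cyclic sum is `η ∧
  -- T(ξ, ·, ·)`.
  refine ⟨.ofFun fun X Y Z ↦ -2 * (A.η X * B Z (A.φ Y) + A.η Y * B X (A.φ Z)
    + A.η Z * B Y (A.φ X)), ⟨fun X Y Z ↦ ?_, fun X Y Z ↦ ?_⟩, fun X Y Z ↦ ?_⟩ <;>
    simp only [Tensor3.ofFun_apply]
  · rw [hB Z Y, hB X Z, hB Y X]; ring
  · rw [hB Z Y, hB X Z, hB Y X]; ring
  · rw [h, hB (A.φ Z) Y, hB (A.φ Y) X]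
    simp only [A.φ_φ, map_add, map_neg, map_smul, hB', smul_zero, η_φ]
    ring

/-- Tensors determined by a symmetric, `φ`-invariant form `α(X, ξ, Z)`, as in the classes `C₆` and
`C₇`, come from 3-forms. -/
theorem mem_charSpace_of_symm {α : Tensor3 V} (h : α ∈ A.tensorSpace)
    (hs : ∀ X Z, α X A.ξ Z = α Z A.ξ X)
    (hφ : ∀ X Z, α (A.φ X) A.ξ (A.φ Z) = α X A.ξ Z)
    (h1 : ∀ X Y Z, α X Y Z = A.η Y * α X A.ξ Z - A.η Z * α X A.ξ Y) :
    α ∈ A.charSpace := by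
  have e1 : ∀ X, α X A.ξ A.ξ = 0 := tensorSpace_apply_ξ_ξ h
  refine mem_charSpace_of_bilin (α.flip A.ξ) (fun X ↦ ?_) (fun X Z ↦ ?_)
    fun X Y Z ↦ ?_ <;> simp only [LinearMap.flip_apply]
  · rw [e1]
  · rw [← hφ]
    simp only [A.φ_φ, map_add, map_neg, map_smul, e1, smul_zero]
    rw [hs Z]; ring
  · rw [h1, hs Z Y]; ring

variable [FiniteDimensional ℝ V]

theorem C6_le_charSpace : A.C6 ≤ A.charSpace := by
  rintro α ⟨h, h1⟩
  refine mem_charSpace_of_symm h (fun X Z ↦ ?_) (fun X Z ↦ ?_) fun X Y Z ↦ ?_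
  · rw [h1, h1 Z, inner_ξ, inner_ξ, real_inner_comm]; ring
  · rw [h1, h1 X, inner_ξ, inner_ξ, A.inner_φ_φ, A.η_φ, A.η_φ, A.η_ξ]; ring
  · rw [h1, h1 X A.ξ, h1 X A.ξ, inner_ξ, A.η_ξ]; ring

theorem C7_le_charSpace : A.C7 ≤ A.charSpace := by
  rintro α ⟨h, h1, -⟩
  have e1 : ∀ X, α X A.ξ A.ξ = 0 := tensorSpace_apply_ξ_ξ h
  have e2 : ∀ Y Z, α A.ξ Y Z = 0 := fun Y Z ↦ by rw [h1]; simp [nablaEta]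
  have e3 : ∀ X Y Z, α X Y Z = - A.η Z * α Y A.ξ X + A.η Y * α (A.φ X) A.ξ (A.φ Z) :=
    fun X Y Z ↦ by
      rw [h1]
      simp only [nablaEta, A.φ_φ, map_add, map_neg, map_smul, e1, smul_zero]
      ring
  have e4 : ∀ X Z, α (A.φ X) A.ξ (A.φ Z) = α X A.ξ Z := fun X Z ↦ by
    have := e3 X A.ξ Z
    rw [e2, A.η_ξ] at this
    linarith
  have e5 : ∀ X Z, α X A.ξ Z = α Z A.ξ X := fun X Z ↦ by
    have h3 := h.1 X Z A.ξ
    rw [e3 X Z, e4, e1, A.η_ξ] at h3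
    linarith
  refine mem_charSpace_of_symm h e5 e4 fun X Y Z ↦ ?_
  rw [e3, e4, e5 Y]; ring

theorem C3_le_charSpace : A.C3 ≤ A.charSpace := by
  rintro α ⟨h, h1, -⟩
  exact mem_charSpace_of_φ_φ h h1

theorem codiff_add_right (α : Tensor3 V) (Y Z : V) :
    codiff α (Y + Z) = codiff α Y + codiff α Z := by
  simp only [codiff, map_add, Finset.sum_add_distrib, neg_add]

theorem codiff_smul_right (α : Tensor3 V) (c : ℝ) (Z : V) :
    codiff α (c • Z) = c * codiff α Z := by
  simp only [codiff, map_smul, smul_eq_mul, ← Finset.mul_sum, mul_neg]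

theorem codiff_φ_φ {α : Tensor3 V} (h : codiff α A.ξ = 0) (Z : V) :
    codiff α (A.φ (A.φ Z)) = -codiff α Z := by
  rw [A.φ_φ, codiff_add_right, codiff_smul_right, h, mul_zero, add_zero, ← neg_one_smul ℝ,
    codiff_smul_right, neg_one_mul]

/-- Applying `φ` to the first two slots preserves `⟨φX, φY⟩` and `Φ(X, Y)` and interchanges the two
remaining summands. Thus `C₄` shares the symmetry of `C₃`, from which it differs only through the
trace. -/
theorem C4_φ_φ {α : Tensor3 V} (h : α ∈ A.C4) (X Y Z : V) :
    α X Y Z - α (A.φ X) (A.φ Y) Z = 0 := by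
  obtain ⟨-, h1, h2⟩ := h
  have e1 : ⟪A.φ (A.φ X), A.φ (A.φ Y)⟫_ℝ = ⟪A.φ X, A.φ Y⟫_ℝ := by simp [A.inner_φ_φ (A.φ X)]
  have e2 : ⟪A.φ (A.φ X), A.φ Z⟫_ℝ = -A.Φ X Z := by
    simp [A.inner_φ_φ (A.φ X), inner_φ_left, Φ]
  have e3 : A.Φ (A.φ X) (A.φ Y) = A.Φ X Y := by
    rw [Φ, Φ, A.inner_φ_φ]; simp
  have e4 : A.Φ (A.φ X) Z = ⟪A.φ X, A.φ Z⟫_ℝ := rfl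
  rw [h1, h1 (A.φ X), e1, e2, e3, e4, codiff_φ_φ h2]
  ring

theorem C4_le_charSpace : A.C4 ≤ A.charSpace :=
  fun _ h ↦ mem_charSpace_of_φ_φ h.1 (C4_φ_φ h)

theorem inner_S (α : Tensor3 V) (X Z : V) : ⟪A.S α X, Z⟫_ℝ = α X A.ξ Z := by
  rw [S, inner_sharp, LinearMap.flip_apply]

theorem inner_h (α : Tensor3 V) (Y Z : V) :
    ⟪A.h α Y, Z⟫_ℝ = 1 / 2 * (-α (A.φ Y) A.ξ (A.φ Z) + α Y A.ξ Z - α A.ξ Y Z) := by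
  simp only [AlmostContactMetricSpace.h, P, LinearMap.smul_apply, LinearMap.sub_apply,
    LinearMap.add_apply, LinearMap.comp_apply, real_inner_smul_left, inner_sub_left,
    inner_add_left, inner_S, inner_sharp, ContinuousLinearMap.coe_coe, inner_φ_left]

theorem h_eq_two_smul_S_iff {α : Tensor3 V} : A.h α = (2 : ℝ) • A.S α ↔
    ∀ Y Z, α A.ξ Y Z = -α (A.φ Y) A.ξ (A.φ Z) - 3 * α Y A.ξ Z := by
  constructor
  · intro h Y Z
    have := congrArg (fun f ↦ ⟪f Y, Z⟫_ℝ) h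
    simp only [inner_h, LinearMap.smul_apply, real_inner_smul_left, inner_S] at this
    linarith
  · intro h
    ext Y
    refine ext_inner_right ℝ fun Z ↦ ?_
    rw [inner_h, LinearMap.smul_apply, real_inner_smul_left, inner_S, h]
    ring

theorem Cmin_le_charSpace : A.Cmin ≤ A.charSpace := by
  rintro α ⟨h, h1⟩
  obtain ⟨β, ⟨hβ, hβ'⟩, γ, ⟨hγ, hγ'⟩, rfl⟩ := Submodule.mem_sup.mp h
  have hα := add_mem hβ hγ
  have hp := h_eq_two_smul_S_iff.mp h1
  have e1 := tensorSpace_apply_ξ_ξ hα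
  -- At `Y = ξ` the condition `h = 2S` says that `α(ξ, ξ, Z)` equals `-3` times itself. This kills
  -- the whole `D₃` component.
  have e0 : ∀ Z, (β + γ) A.ξ A.ξ Z = 0 := fun Z ↦ by
    have := hp A.ξ Z
    rw [φ_ξ, map_zero, LinearMap.zero_apply, LinearMap.zero_apply] at this
    linarith
  have b0 : ∀ Z, β A.ξ A.ξ Z = 0 := fun Z ↦ by
    have := hβ' A.ξ A.ξ Z
    rw [A.η_ξ, tensorSpace_apply_ξ_ξ hβ] at this
    linarith
  have g0 : ∀ Z, γ A.ξ A.ξ Z = 0 := fun Z ↦ by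
    have := e0 Z
    rwa [LinearMap.add_apply, LinearMap.add_apply, LinearMap.add_apply, b0, zero_add] at this
  have g1 : γ = 0 := by
    ext X Y Z
    rw [hγ', hγ.1 A.ξ Y, g0, g0]
    simp
  subst g1
  rw [add_zero] at *
  -- Compare `h = 2S` at `(Y, Z)` and at `(φY, φZ)`: `β(ξ, ·, ·)` changes sign under `φ`, so the
  -- combinations with coefficients `1, 3` and `3, 1` are opposite. Then `β(ξ, ·, ·) = -2 β(·, ξ,
  -- ·)`, and the skewness of the left side passes to the right.
  have e2 : ∀ Y Z, β (A.φ Y) A.ξ (A.φ Z) = -β Y A.ξ Z := fun Y Z ↦ by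
    have k1 := tensorSpace_apply_φ_φ hβ A.ξ Y Z
    have k2 := hp (A.φ Y) (A.φ Z)
    have k3 := hp Y Z
    rw [hβ.1 A.ξ Y A.ξ, b0, b0] at k1
    simp only [A.φ_φ, map_add, map_neg, map_smul, e1, b0, smul_zero, neg_zero, add_zero,
      LinearMap.add_apply, LinearMap.neg_apply, LinearMap.smul_apply] at k2
    linarith
  have e3 : ∀ Y Z, β A.ξ Y Z = -2 * β Y A.ξ Z := fun Y Z ↦ by
    rw [hp, e2]; ring
  have e4 : ∀ Y Z, β Y A.ξ Z = -β Z A.ξ Y := fun Y Z ↦ by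
    have := hβ.1 A.ξ Y Z
    rw [e3, e3] at this
    linarith
  refine mem_charSpace_of_bilin (β.flip A.ξ) e1 (fun X Z ↦ ?_) fun X Y Z ↦ ?_ <;>
    simp only [LinearMap.flip_apply]
  · have := e2 X (A.φ Z)
    simp only [A.φ_φ, map_add, map_neg, map_smul, e1, smul_zero] at this
    rw [e4 Z]
    linarith
  · rw [hβ', e3, hβ.1 X Y A.ξ, e4 Z Y]; ring

end AlmostContactMetricSpace

end

/-! ### Linear algebra: splitting a 3-form into the listed classes. -/

noncomputable section

set_option maxSynthPendingDepth 3

namespace AlmostContactMetricSpace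

variable {n : ℕ} {V : Type*} [NormedAddCommGroup V] [InnerProductSpace ℝ V]
  {A : AlmostContactMetricSpace n V} [FiniteDimensional ℝ V]

/-- In dimension one `V` is spanned by `ξ`. This settles the case in which the factor `1 / (2n)` is
useless. -/
theorem tensorSpace_eq_bot (hn : n = 0) : A.tensorSpace = ⊥ := by
  have hξ : A.ξ ≠ 0 := fun h ↦ by simpa [h] using A.η_ξ
  have h1 := (finrank_eq_one_iff_of_nonzero' A.ξ hξ).mp (by rw [A.finrank_eq, hn])
  refine eq_bot_iff.mpr fun α h ↦ ?_
  rw [Submodule.mem_bot]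
  ext X Y Z
  obtain ⟨c, rfl⟩ := h1 Y
  obtain ⟨d, rfl⟩ := h1 Z
  simp [tensorSpace_apply_ξ_ξ h]

section Trace

variable {ι : Type*} [Fintype ι] (e : OrthonormalBasis ι ℝ V)

theorem sum_inner_mul (v : V) (f : V → ℝ) (hadd : ∀ x y, f (x + y) = f x + f y)
    (hsmul : ∀ (c : ℝ) x, f (c • x) = c * f x) : ∑ i, ⟪e i, v⟫_ℝ * f (e i) = f v := by
  let g : V →ₗ[ℝ] ℝ := ⟨⟨f, hadd⟩, hsmul⟩
  change ∑ i, ⟪e i, v⟫_ℝ * g (e i) = g v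
  conv_rhs => rw [← e.sum_repr' v]
  simp

variable (A) in
theorem sum_inner_φ_φ : ∑ i, ⟪A.φ (e i), A.φ (e i)⟫_ℝ = 2 * n := by
  have h1 : ∑ i, A.η (e i) * A.η (e i) = 1 := by
    have := sum_inner_mul e A.ξ A.η (map_add A.η) (fun c x ↦ map_smul A.η c x)
    simpa only [inner_ξ, A.η_ξ] using this
  have h2 : ∑ i, ⟪e i, e i⟫_ℝ = 2 * n + 1 := by
    have : Fintype.card ι = 2 * n + 1 := by
      rw [← A.finrank_eq, Module.finrank_eq_card_basis e.toBasis]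
    simp [this]
  simp only [A.inner_φ_φ, Finset.sum_sub_distrib, h1, h2]
  ring

end Trace

theorem inner_φ_self (v : V) : ⟪v, A.φ v⟫_ℝ = 0 := by
  have := A.inner_φ_left v v
  rw [real_inner_comm] at this
  linarith

/-- The tensor of type `C₄` with codifferential `codiff β`. -/
def C4part (A : AlmostContactMetricSpace n V) (β : Tensor3 V) : Tensor3 V :=
  .ofFun (fun X Y Z ↦ -(1 / (2 * ((n : ℝ) - 1))) *
      (⟪A.φ X, A.φ Y⟫_ℝ * codiff β Z - ⟪A.φ X, A.φ Z⟫_ℝ * codiff β Y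
        - A.Φ X Y * codiff β (A.φ Z) + A.Φ X Z * codiff β (A.φ Y)))
    (by intros; simp only [Φ, map_add, inner_add_left]; ring)
    (by intros; simp only [Φ, map_smul, real_inner_smul_left]; ring)
    (by intros; simp only [Φ, map_add, inner_add_right, codiff_add_right]; ring)
    (by intros; simp only [Φ, map_smul, real_inner_smul_right, codiff_smul_right]; ring)
    (by intros; simp only [Φ, map_add, inner_add_right, codiff_add_right]; ring)
    (by intros; simp only [Φ, map_smul, real_inner_smul_right, codiff_smul_right]; ring)

theorem C4part_apply (β : Tensor3 V) (X Y Z : V) :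
    A.C4part β X Y Z = -(1 / (2 * ((n : ℝ) - 1))) *
      (⟪A.φ X, A.φ Y⟫_ℝ * codiff β Z - ⟪A.φ X, A.φ Z⟫_ℝ * codiff β Y
        - A.Φ X Y * codiff β (A.φ Z) + A.Φ X Z * codiff β (A.φ Y)) := rfl

/-- The normalization `1 / (2(n - 1))` is chosen for this: the four terms trace to `2n`, `-1`, `0`
and `-1` times `δΦ(Z)`, with total `2(n - 1)`. -/
theorem codiff_C4part {β : Tensor3 V} (hβ : codiff β A.ξ = 0) (hn : n ≠ 1) (Z : V) :
    codiff (A.C4part β) Z = codiff β Z := by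
  have h1 : ∀ v, ⟪A.φ v, A.φ Z⟫_ℝ = -⟪v, A.φ (A.φ Z)⟫_ℝ := fun v ↦ A.inner_φ_left v _
  have hn' : (n : ℝ) - 1 ≠ 0 := by
    rw [sub_ne_zero]; exact_mod_cast hn
  rw [codiff]
  simp only [C4part_apply, ← Finset.mul_sum, Finset.sum_add_distrib, Finset.sum_sub_distrib,
    ← Finset.sum_mul, sum_inner_φ_φ, h1, Φ, inner_φ_self, zero_mul, Finset.sum_const_zero, neg_mul,
    Finset.sum_neg_distrib]
  rw [sum_inner_mul _ _ _ (codiff_add_right β) (codiff_smul_right β),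
    sum_inner_mul _ _ (fun v ↦ codiff β (A.φ v)) (by intros; rw [map_add, codiff_add_right])
      (by intros; rw [map_smul, codiff_smul_right]), codiff_φ_φ hβ]
  field_simp
  ring

theorem C4part_mem_tensorSpace {β : Tensor3 V} (hβ : codiff β A.ξ = 0) :
    A.C4part β ∈ A.tensorSpace := by
  refine ⟨fun X Y Z ↦ ?_, fun X Y Z ↦ ?_⟩
  · rw [C4part_apply, C4part_apply]; ring
  · simp only [C4part_apply, codiff_φ_φ hβ, Φ, φ_ξ, hβ, inner_zero_right]
    have h1 : ∀ Y, ⟪A.φ X, A.φ (A.φ Y)⟫_ℝ = ⟪X, A.φ Y⟫_ℝ := fun Y ↦ by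
      rw [A.inner_φ_φ, η_φ]; ring
    have h2 : ∀ Y, ⟪X, A.φ (A.φ Y)⟫_ℝ = -⟪A.φ X, A.φ Y⟫_ℝ := fun Y ↦ by
      rw [A.inner_φ_left, neg_neg]
    have h3 : codiff β (A.φ 0) = 0 := by
      rw [map_zero]; simpa using codiff_smul_right β 0 0
    have h4 : codiff β 0 = 0 := by
      simpa using codiff_smul_right β 0 0
    rw [h1, h1, h2, h2, h4]
    ring

/-- Subtracting the `C₄` tensor with the same codifferential leaves a trace-free tensor with the
same symmetry. The normalization degenerates for `n = 1`, so vanishing is assumed there. -/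
theorem mem_C3_sup_C4 {β : Tensor3 V} (h : β ∈ A.tensorSpace)
    (h1 : ∀ X Y Z, β X Y Z - β (A.φ X) (A.φ Y) Z = 0) (hn : n = 1 → β = 0) :
    β ∈ A.C3 ⊔ A.C4 := by
  by_cases hn1 : n = 1
  · rw [hn hn1]; exact zero_mem _
  have h2 : codiff β A.ξ = 0 := by
    have e1 : ∀ X, β X X A.ξ = 0 := fun X ↦ by
      have := h1 X A.ξ X
      rw [φ_ξ, map_zero, LinearMap.zero_apply, sub_zero] at this
      rw [h.1, this, neg_zero]
    simp [codiff, e1]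
  have h3 : A.C4part β ∈ A.C4 :=
    ⟨C4part_mem_tensorSpace h2, fun X Y Z ↦ by simp only [codiff_C4part h2 hn1, C4part_apply],
      by rw [codiff_C4part h2 hn1, h2]⟩
  have h4 : β - A.C4part β ∈ A.C3 := by
    refine ⟨sub_mem h h3.1, fun X Y Z ↦ ?_, fun Z ↦ ?_⟩
    · have k : A.C4part β X Y Z - A.C4part β (A.φ X) (A.φ Y) Z = 0 := C4_φ_φ h3 X Y Z
      simp only [LinearMap.sub_apply]
      linear_combination h1 X Y Z - k
    · rw [sub_eq_add_neg, ← neg_one_smul ℝ, codiff_add, codiff_smul, codiff_C4part h2 hn1]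
      ring
  rw [← sub_add_cancel β (A.C4part β)]
  exact Submodule.add_mem_sup h4 h3

/-- A horizontal 3-form vanishes in dimension three. -/
theorem IsThreeForm.eq_zero_of_horizontal {T : Tensor3 V} (hT : IsThreeForm T)
    (h : ∀ Y Z, T A.ξ Y Z = 0) (hn : n = 1) : T = 0 := by
  ext X Y Z
  by_contra hne
  have hne : T X Y Z ≠ 0 := hne
  have hs₁ : ∀ X Z, T X X Z = 0 := fun X Z ↦ by linarith [hT.1 X X Z]
  have hs₂ : ∀ X Z, T X Z X = 0 := fun X Z ↦ by rw [hT.2, hs₁, neg_zero]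
  -- Contracting with the other two vectors isolates `aᵢ T(X, Y, Z)`. This is used twice: for the
  -- independence of `X, Y, Z`, and for the coordinates of `ξ` in the resulting basis.
  have key : ∀ a : Fin 3 → ℝ, (∀ U W, T (∑ i, a i • ![X, Y, Z] i) U W = 0) → ∀ i, a i = 0 := by
    intro a ha
    simp only [Fin.sum_univ_three, map_add, map_smul, LinearMap.add_apply, LinearMap.smul_apply,
      smul_eq_mul, Matrix.cons_val] at ha
    have h1 := ha Y Z
    have h2 := ha Z X
    have h3 := ha X Y
    simp only [hs₁, hs₂, ← hT.cyc X Y Z, hT.cyc Z X Y, mul_zero, add_zero, zero_add, mul_eq_zero, hne,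
      or_false] at h1 h2 h3
    intro i
    fin_cases i <;> assumption
  have hli : LinearIndependent ℝ ![X, Y, Z] :=
    Fintype.linearIndependent_iff.mpr fun a ha ↦ key a fun U W ↦ by rw [ha]; simp
  let b := basisOfLinearIndependentOfCardEqFinrank hli (by rw [A.finrank_eq, hn]; simp)
  have hb : ∑ i, b.repr A.ξ i • ![X, Y, Z] i = A.ξ := by
    have := b.sum_repr A.ξ
    simpa only [b, coe_basisOfLinearIndependentOfCardEqFinrank] using this
  have h0 := key (b.repr A.ξ) (by rw [hb]; exact h)
  have hξ : A.ξ = 0 := by rw [← hb]; simp [h0]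
  simpa [hξ] using A.η_ξ

/-- The tensors coming from horizontal 3-forms decompose into parts of class `C₁`, `C₃` and `C₄`. -/
theorem mem_sup_of_horizontal {α T : Tensor3 V} (hT : IsThreeForm T) (h : ∀ Y Z, T A.ξ Y Z = 0)
    (hα : A.IsCharTorsion α T) : α ∈ A.C1 ⊔ A.C3 ⊔ A.C4 := by
  have h' : ∀ X Z, T X A.ξ Z = 0 := fun X Z ↦ by rw [hT.1, h, neg_zero]
  have h'' : ∀ X Y, T X Y A.ξ = 0 := fun X Z ↦ by rw [hT.2, h', neg_zero]
  have p1 : ∀ X Y Z, T (A.φ (A.φ X)) Y Z = -T X Y Z := fun X Y Z ↦ by simp [A.φ_φ, h]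
  have p2 : ∀ X Y Z, T X (A.φ (A.φ Y)) Z = -T X Y Z := fun X Y Z ↦ by simp [A.φ_φ, h']
  have p3 : ∀ X Y Z, T X Y (A.φ (A.φ Z)) = -T X Y Z := fun X Y Z ↦ by simp [A.φ_φ, h'']
  -- On the `±i` eigenspaces of `φ`, `α₁` agrees with `α` on types (3,0)+(0,3) and vanishes on
  -- (2,1)+(1,2); for `β` it is the other way round.
  let α₁ : Tensor3 V := .ofFun fun X Y Z ↦ 1 / 4 * (T (A.φ X) Y Z + T X (A.φ Y) Z + T X Y (A.φ Z)
    - T (A.φ X) (A.φ Y) (A.φ Z))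
  let β : Tensor3 V := .ofFun fun X Y Z ↦ 1 / 4 * (-T (A.φ X) Y Z + T X (A.φ Y) Z + T X Y (A.φ Z)
    + T (A.φ X) (A.φ Y) (A.φ Z))
  have h1 : α₁ ∈ A.C1 := by
    refine ⟨⟨fun X Y Z ↦ ?_, fun X Y Z ↦ ?_⟩, fun X Y ↦ ?_, fun X Y ↦ ?_⟩ <;>
      simp only [α₁, nablaEta, Tensor3.ofFun_apply]
    · rw [hT.2 (A.φ X), hT.2 X (A.φ Y), hT.2 X Y, hT.2 (A.φ X) (A.φ Y)]; ring
    · simp only [p2, p3, h', h'', φ_ξ, map_zero, LinearMap.zero_apply]; ring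
    · linarith [hT.1 (A.φ X) X Y, hT.1 X X (A.φ Y), hT.1 (A.φ X) (A.φ X) (A.φ Y)]
    · simp [h']
  have h2 : β ∈ A.C3 ⊔ A.C4 := by
    refine mem_C3_sup_C4 ⟨fun X Y Z ↦ ?_, fun X Y Z ↦ ?_⟩ (fun X Y Z ↦ ?_) fun hn ↦ ?_
    · simp only [β, Tensor3.ofFun_apply]
      rw [hT.2 (A.φ X), hT.2 X (A.φ Y), hT.2 X Y, hT.2 (A.φ X) (A.φ Y)]; ring
    · simp only [β, Tensor3.ofFun_apply, p2, p3, h', h'', φ_ξ, map_zero, LinearMap.zero_apply]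
      ring
    · simp only [β, Tensor3.ofFun_apply, p1, p2]
      ring
    · have := hT.eq_zero_of_horizontal h hn
      ext X Y Z
      simp [β, this]
  have h3 : α = α₁ + β := by
    ext X Y Z
    rw [hα]
    simp only [α₁, β, LinearMap.add_apply, Tensor3.ofFun_apply]
    ring
  rw [h3, sup_assoc]
  exact Submodule.add_mem_sup h1 h2

/-- This is the splitting of `b` into a multiple of the metric on `H` and a trace-free part, since
`δΦ(ξ)` is the trace of `b`. -/
theorem mem_C6_sup_C7 {b : V →ₗ[ℝ] V →ₗ[ℝ] ℝ} (hn : n ≠ 0) (h : ∀ Z, b A.ξ Z = 0)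
    (hs : ∀ X Z, b X Z = b Z X) (hφ : ∀ X Z, b (A.φ X) (A.φ Z) = b X Z) {α : Tensor3 V}
    (hα : ∀ X Y Z, α X Y Z = A.η Y * b X Z - A.η Z * b X Y) : α ∈ A.C6 ⊔ A.C7 := by
  have h' : ∀ X, b X A.ξ = 0 := fun X ↦ by rw [hs, h]
  have hn' : (n : ℝ) ≠ 0 := by exact_mod_cast hn
  let t : ℝ := codiff α A.ξ
  let α₆ : Tensor3 V := .ofFun fun X Y Z ↦ 1 / (2 * (n : ℝ)) *
      (A.η Y * ⟪X, Z⟫_ℝ - A.η Z * ⟪X, Y⟫_ℝ) * t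
  have hα₆ : ∀ X Y Z, α₆ X Y Z = 1 / (2 * (n : ℝ)) *
      (A.η Y * ⟪X, Z⟫_ℝ - A.η Z * ⟪X, Y⟫_ℝ) * t := fun _ _ _ ↦ rfl
  have hα' : α ∈ A.tensorSpace := by
    refine ⟨fun X Y Z ↦ ?_, fun X Y Z ↦ ?_⟩ 
    · rw [hα, hα]; ring
    · simp only [hα, h', η_φ, A.η_ξ]; ring
  have hc : ∀ Z, codiff α Z = A.η Z * t := fun Z ↦ by
    have k : ∀ Z, ∑ i, A.η (stdOrthonormalBasis ℝ V i) * b (stdOrthonormalBasis ℝ V i) Z = 0 :=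
      fun Z ↦ by
        have := sum_inner_mul (stdOrthonormalBasis ℝ V) A.ξ (fun v ↦ b v Z)
          (by intros; simp) (by intros; simp)
        simpa only [inner_ξ, h] using this
    simp only [t, codiff, hα, Finset.sum_sub_distrib, k, A.η_ξ, one_mul, ← Finset.mul_sum]
    ring
  have hc6 : ∀ Z, codiff α₆ Z = A.η Z * t := fun Z ↦ by
    have k := sum_inner_mul (stdOrthonormalBasis ℝ V) Z A.η (map_add A.η)
      (fun c x ↦ map_smul A.η c x)
    have k2 : ∑ i, ⟪stdOrthonormalBasis ℝ V i, stdOrthonormalBasis ℝ V i⟫_ℝ = 2 * n + 1 := by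
      simp [A.finrank_eq]
    simp only [mul_comm ⟪_, _⟫_ℝ (A.η _)] at k
    simp only [codiff, hα₆, ← Finset.sum_mul, ← Finset.mul_sum, Finset.sum_sub_distrib, k, k2]
    field_simp
    ring
  have h6 : α₆ ∈ A.C6 := by
    refine ⟨⟨fun X Y Z ↦ ?_, fun X Y Z ↦ ?_⟩, fun X Y Z ↦ ?_⟩
    · rw [hα₆, hα₆]; ring
    · simp only [hα₆, η_φ, inner_ξ, A.η_ξ]; ring
    · rw [hc6, hα₆, A.η_ξ, one_mul]
  have h7 : α - α₆ ∈ A.C7 := by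
    refine ⟨sub_mem hα' h6.1, fun X Y Z ↦ ?_, fun Z ↦ ?_⟩
    · simp only [nablaEta, LinearMap.sub_apply, hα, hα₆, A.η_ξ, η_φ, h', A.inner_φ_φ, hφ, inner_ξ]
      have e1 : b Y (A.φ (A.φ X)) = -b X Y := by simp [A.φ_φ, h', hs Y X]
      have e2 : ⟪Y, A.φ (A.φ X)⟫_ℝ = -⟪X, Y⟫_ℝ + A.η X * A.η Y := by
        simp [A.φ_φ, inner_add_right, inner_smul_right, inner_ξ, real_inner_comm]
      simp only [e1, e2]
      ring
    · rw [sub_eq_add_neg, ← neg_one_smul ℝ, codiff_add, codiff_smul, hc, hc6]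
      ring
  rw [← add_sub_cancel α₆ α]
  exact Submodule.add_mem_sup h6 h7

theorem mem_Cmin {b : V →ₗ[ℝ] V →ₗ[ℝ] ℝ} (h : ∀ Z, b A.ξ Z = 0)
    (hs : ∀ X Z, b X Z = -b Z X) (hφ : ∀ X Z, b (A.φ X) (A.φ Z) = -b X Z) {α : Tensor3 V}
    (hα : ∀ X Y Z, α X Y Z = -2 * A.η X * b Y Z + A.η Y * b X Z - A.η Z * b X Y) : 
    α ∈ A.Cmin := by
  have h' : ∀ X, b X A.ξ = 0 := fun X ↦ by rw [hs, h, neg_zero]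
  refine ⟨Submodule.mem_sup_left ⟨⟨fun X Y Z ↦ ?_, fun X Y Z ↦ ?_⟩, fun X Y Z ↦ ?_⟩, ?_⟩
  · rw [hα, hα, hs Y Z]; ring
  · simp only [hα, h, h', η_φ, A.η_ξ, hφ]; ring
  · simp only [hα, h, h', A.η_ξ]; ring
  · refine h_eq_two_smul_S_iff.mpr fun Y Z ↦ ?_
    simp only [hα, h, h', η_φ, A.η_ξ, hφ]; ring

theorem mem_sup_of_vertical {α T : Tensor3 V} (hT : IsThreeForm T)
    (h : ∀ X Y Z, T X Y Z = A.η X * T A.ξ Y Z + A.η Y * T A.ξ Z X + A.η Z * T A.ξ X Y)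
    (hα : A.IsCharTorsion α T) (hn : n ≠ 0) : α ∈ A.C6 ⊔ A.C7 ⊔ A.Cmin := by
  have h0 : ∀ Z, T A.ξ A.ξ Z = 0 := fun Z ↦ by linarith [hT.1 A.ξ A.ξ Z]
  have h0' : ∀ Z, T A.ξ Z A.ξ = 0 := fun Z ↦ by rw [hT.2, h0, neg_zero]
  let u : V →ₗ[ℝ] V →ₗ[ℝ] ℝ := T A.ξ ∘ₗ (A.φ : V →ₗ[ℝ] V)
  have hu : ∀ X Z, u X Z = T A.ξ (A.φ X) Z := fun _ _ ↦ rfl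
  -- The relation between `α` and `T` gives `α(X, ξ, Z) = u(Z, X) / 2`; `b` and `c` are the
  -- symmetric and skew parts of this form. As `φ` transposes `u` (`hu3`), `b` is `φ`-invariant and
  -- `c` anti-invariant.
  let b : V →ₗ[ℝ] V →ₗ[ℝ] ℝ := (1 / 4 : ℝ) • (u.flip + u)
  let c : V →ₗ[ℝ] V →ₗ[ℝ] ℝ := (1 / 4 : ℝ) • (u.flip - u)
  have hb : ∀ X Z, b X Z = 1 / 4 * (u Z X + u X Z) := fun _ _ ↦ rfl
  have hc : ∀ X Z, c X Z = 1 / 4 * (u Z X - u X Z) := fun _ _ ↦ rfl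
  have hu1 : ∀ Z, u A.ξ Z = 0 := fun Z ↦ by simp [hu]
  have hu2 : ∀ Z, u Z A.ξ = 0 := fun Z ↦ by simp [hu, h0']
  have hu3 : ∀ X Z, u (A.φ X) (A.φ Z) = u Z X := fun X Z ↦ by
    simp only [hu, A.φ_φ, map_add, map_neg, map_smul, h0, LinearMap.add_apply, LinearMap.neg_apply,
      LinearMap.smul_apply, smul_zero, add_zero]
    rw [hT.2, neg_neg]
  let β : Tensor3 V := .ofFun fun X Y Z ↦ A.η Y * b X Z - A.η Z * b X Y
  let γ : Tensor3 V := .ofFun fun X Y Z ↦ -2 * A.η X * c Y Z + A.η Y * c X Z - A.η Z * c X Y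
  have h1 : β ∈ A.C6 ⊔ A.C7 := by
    refine mem_C6_sup_C7 (b := b) hn (fun Z ↦ ?_) (fun X Z ↦ ?_) (fun X Z ↦ ?_) fun _ _ _ ↦ rfl
    · rw [hb, hu1, hu2]; ring
    · rw [hb, hb]; ring
    · rw [hb, hb, hu3, hu3]; ring
  have h2 : γ ∈ A.Cmin := by
    refine mem_Cmin (b := c) (fun Z ↦ ?_) (fun X Z ↦ ?_) (fun X Z ↦ ?_) fun _ _ _ ↦ rfl
    · rw [hc, hu1, hu2]; ring
    · rw [hc, hc]; ring
    · rw [hc, hc, hu3, hu3]; ring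
  have h3 : α = β + γ := by
    ext X Y Z
    rw [hα, h X Y, h X (A.φ Y)]
    simp only [β, γ, LinearMap.add_apply, Tensor3.ofFun_apply, hb, hc, η_φ, hu]
    rw [hT.2 A.ξ Y (A.φ Z), hT.2 A.ξ X (A.φ Y)]
    ring
  rw [h3]
  exact Submodule.add_mem_sup h1 h2

/-- The projection onto `H` is `-φ²`, whence the sign of the first term. Expanding it, every term
with two entries `ξ` drops out. -/
theorem IsThreeForm.eq_horizontal_add {T : Tensor3 V} (hT : IsThreeForm T) (X Y Z : V) :
    T X Y Z = -T (A.φ (A.φ X)) (A.φ (A.φ Y)) (A.φ (A.φ Z)) +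
      (A.η X * T A.ξ Y Z + A.η Y * T A.ξ Z X + A.η Z * T A.ξ X Y) := by
  have h0 : ∀ Z, T A.ξ A.ξ Z = 0 := fun Z ↦ by linarith [hT.1 A.ξ A.ξ Z]
  have h0' : ∀ Z, T A.ξ Z A.ξ = 0 := fun Z ↦ by rw [hT.2, h0, neg_zero]
  have h0'' : ∀ Z, T Z A.ξ A.ξ = 0 := fun Z ↦ by rw [hT.1, h0', neg_zero]
  simp only [A.φ_φ, map_add, map_neg, map_smul, LinearMap.add_apply, LinearMap.neg_apply,
      LinearMap.smul_apply, smul_eq_mul, h0, h0', h0'']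
  rw [hT.cyc X Y A.ξ, hT.cyc Y A.ξ X, hT.1 X A.ξ Z, hT.2 A.ξ Z X]
  ring

theorem charSpace_le_tensorSpace : A.charSpace ≤ A.tensorSpace := by
  rintro α ⟨T, hT, h⟩
  have h0 : ∀ X, T X A.ξ A.ξ = 0 := fun X ↦ by linarith [hT.2 X A.ξ A.ξ]
  refine ⟨fun X Y Z ↦ ?_, fun X Y Z ↦ ?_⟩
  · rw [h, h, hT.2 X Y, hT.2 X (A.φ Y)]; ring
  · simp only [h _, A.φ_φ, map_add, map_neg, map_smul, φ_ξ, map_zero, LinearMap.add_apply,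
      LinearMap.neg_apply, LinearMap.smul_apply, LinearMap.zero_apply, smul_eq_mul]
    ring

/-- The horizontal part of a tensor. -/
def horizontalPart (A : AlmostContactMetricSpace n V) (T : Tensor3 V) : Tensor3 V :=
  .ofFun fun X Y Z ↦ -T (A.φ (A.φ X)) (A.φ (A.φ Y)) (A.φ (A.φ Z))

theorem horizontalPart_apply (T : Tensor3 V) (X Y Z : V) :
    A.horizontalPart T X Y Z = -T (A.φ (A.φ X)) (A.φ (A.φ Y)) (A.φ (A.φ Z)) := rfl

theorem IsThreeForm.horizontalPart {T : Tensor3 V} (hT : IsThreeForm T) :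
    IsThreeForm (A.horizontalPart T) := by
  refine ⟨fun X Y Z ↦ ?_, fun X Y Z ↦ ?_⟩ <;> simp only [horizontalPart_apply]
  · rw [hT.1]
  · rw [hT.2]

theorem IsThreeForm.sub {T U : Tensor3 V} (hT : IsThreeForm T) (hU : IsThreeForm U) :
    IsThreeForm (T - U) := by
  refine ⟨fun X Y Z ↦ ?_, fun X Y Z ↦ ?_⟩ <;> simp only [LinearMap.sub_apply]
  · rw [hT.1, hU.1]; ring
  · rw [hT.2, hU.2]; ring

theorem IsThreeForm.sub_horizontalPart_apply {T : Tensor3 V} (hT : IsThreeForm T) (X Y Z : V) :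
    (T - A.horizontalPart T) X Y Z = A.η X * (T - A.horizontalPart T) A.ξ Y Z +
      A.η Y * (T - A.horizontalPart T) A.ξ Z X + A.η Z * (T - A.horizontalPart T) A.ξ X Y := by
  simp only [LinearMap.sub_apply, horizontalPart_apply, φ_ξ, map_zero, LinearMap.zero_apply]
  rw [hT.eq_horizontal_add (A := A) X Y Z]
  ring

theorem IsCharTorsion.horizontalPart {α T : Tensor3 V} (h : A.IsCharTorsion α T) :
    A.IsCharTorsion (A.horizontalPart α) (A.horizontalPart T) := fun X Y Z ↦ by
  simp only [horizontalPart_apply, h _]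
  ring

theorem IsCharTorsion.sub {α β T U : Tensor3 V} (h : A.IsCharTorsion α T)
    (k : A.IsCharTorsion β U) : A.IsCharTorsion (α - β) (T - U) := fun X Y Z ↦ by
  simp only [LinearMap.sub_apply, h _, k _]
  ring

theorem mem_sup_of_mem_charSpace {α : Tensor3 V} (h : α ∈ A.charSpace) :
    α ∈ A.C1 ⊔ A.C3 ⊔ A.C4 ⊔ A.C6 ⊔ A.C7 ⊔ A.Cmin := by
  by_cases hn : n = 0
  · have := charSpace_le_tensorSpace h
    rw [tensorSpace_eq_bot hn, Submodule.mem_bot] at this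
    rw [this]
    exact zero_mem _
  obtain ⟨T, hT, h⟩ := h
  have h1 := mem_sup_of_horizontal hT.horizontalPart
    (fun Y Z ↦ by simp [horizontalPart_apply]) h.horizontalPart
  have h2 := mem_sup_of_vertical (hT.sub hT.horizontalPart) hT.sub_horizontalPart_apply
    (h.sub h.horizontalPart) hn
  rw [← add_sub_cancel (A.horizontalPart α) α, sup_assoc, sup_assoc, ← sup_assoc A.C6]
  exact Submodule.add_mem_sup h1 h2

theorem charSpace_eq_sup :
    A.charSpace = A.C1 ⊔ A.C3 ⊔ A.C4 ⊔ A.C6 ⊔ A.C7 ⊔ A.Cmin :=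
  le_antisymm (fun _ ↦ mem_sup_of_mem_charSpace)
    (sup_le (sup_le (sup_le (sup_le (sup_le C1_le_charSpace C3_le_charSpace) C4_le_charSpace)
      C6_le_charSpace) C7_le_charSpace) Cmin_le_charSpace)

theorem horizontalPart_eq_zero {α : Tensor3 V}
    (h : ∀ X Y Z, A.η X = 0 → A.η Y = 0 → A.η Z = 0 → α X Y Z = 0) : A.horizontalPart α = 0 := by
  ext X Y Z
  simp [horizontalPart_apply, h]

/-- The torsion of a characteristic connection is vertical in the `H`-parallel case. -/
theorem IsCharTorsion.horizontalPart_eq_zero {α T : Tensor3 V} (h : A.IsCharTorsion α T)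
    (hT : IsThreeForm T) (hα : A.horizontalPart α = 0) : A.horizontalPart T = 0 := by
  ext X Y Z
  have h1 := h.horizontalPart.apply_φ hT.horizontalPart X Y (A.φ Z)
  simp only [hα, LinearMap.zero_apply] at h1
  have h2 : A.horizontalPart T X Y (A.φ (A.φ Z)) = -A.horizontalPart T X Y Z := by
    simp [horizontalPart_apply, A.φ_φ (A.φ (A.φ Z))]
  rw [h2] at h1
  simpa using h1

theorem IsCharTorsion.apply_of_horizontalPart_eq_zero {α T : Tensor3 V} (h : A.IsCharTorsion α T)
    (hT : IsThreeForm T) (hα : A.horizontalPart α = 0) (X Y Z : V) :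
    T X Y Z = A.η X * T A.ξ Y Z + A.η Y * T A.ξ Z X + A.η Z * T A.ξ X Y := by
  have := hT.sub_horizontalPart_apply (A := A) X Y Z
  rwa [h.horizontalPart_eq_zero hT hα, sub_zero] at this

theorem mem_sup_of_horizontalPart_eq_zero {α : Tensor3 V} (h : α ∈ A.charSpace)
    (hα : A.horizontalPart α = 0) : α ∈ A.C6 ⊔ A.C7 ⊔ A.Cmin := by
  by_cases hn : n = 0
  · have := charSpace_le_tensorSpace h
    rw [tensorSpace_eq_bot hn, Submodule.mem_bot] at this
    rw [this]
    exact zero_mem _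
  obtain ⟨T, hT, h⟩ := h
  exact mem_sup_of_vertical hT (h.apply_of_horizontalPart_eq_zero hT hα) h hn

end AlmostContactMetricSpace

end

/-! ### Smoothness of tensors and of the Levi-Civita connection. -/

noncomputable section

section Smoothness

variable {E : Type*} [NormedAddCommGroup E] [NormedSpace ℝ E]
  {H : Type*} [TopologicalSpace H] {I : ModelWithCorners ℝ E H}
  {M : Type*} [TopologicalSpace M] [ChartedSpace H M]

theorem contMDiffAt_matrix_det {ι : Type*} [Fintype ι] [DecidableEq ι] {k : ℕ∞ω}
    {G : M → Matrix ι ι ℝ} {x₀ : M} (h : ∀ i j, CMDiffAt k (fun x ↦ G x i j) x₀) :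
    CMDiffAt k (fun x ↦ (G x).det) x₀ := by
  simp only [Matrix.det_apply']
  exact contMDiffAt_finsetSum fun σ _ ↦
    contMDiffAt_const.mul (contMDiffAt_finsetProd fun i _ ↦ h _ _)

theorem contMDiffAt_of_apply [FiniteDimensional ℝ E] {F : Type*} [NormedAddCommGroup F]
    [NormedSpace ℝ F] {k : ℕ∞ω} {f : M → E →L[ℝ] F} {x₀ : M}
    (h : ∀ v, CMDiffAt k (fun x ↦ f x v) x₀) : CMDiffAt k f x₀ := by
  let b := Module.finBasis ℝ E
  let c : ∀ i, E →L[ℝ] ℝ := fun i ↦ LinearMap.toContinuousLinearMap (b.coord i)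
  have : f = fun x ↦ ∑ i, ContinuousLinearMap.smulRightL ℝ E F (c i) (f x (b i)) := by
    ext x v
    conv_lhs => rw [← b.sum_repr v, map_sum]
    simp [c]
  rw [this]
  exact contMDiffAt_finsetSum fun i _ ↦
    (ContinuousLinearMap.contMDiff _).contMDiffAt.comp x₀ (h (b i))

variable [IsManifold I ∞ M]

theorem ContMDiffAt.mvfderiv_apply {f : M → ℝ} {X : Π x : M, TangentSpace I x} {x₀ : M}
    (hf : CMDiffAt ∞ f x₀) (hX : CMDiffAt ∞ (T% X) x₀) :
    CMDiffAt ∞ (fun x ↦ d% f x (X x)) x₀ := by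
  have h1 := hf.mfderiv_const (m := ∞) (by simp)
  have h2 := ContMDiffAt.clm_apply_of_inCoordinates (b₁ := id) (b₂ := f) (v := X) h1 hX hf
  exact (contMDiff_snd_tangentBundle_modelSpace ℝ 𝓘(ℝ, ℝ)).contMDiffAt.comp x₀ h2

theorem ContMDiffAt.mlieBracket_smooth [FiniteDimensional ℝ E] {X Y : Π x : M, TangentSpace I x} {x₀ : M}
    (hX : CMDiffAt ∞ (T% X) x₀) (hY : CMDiffAt ∞ (T% Y) x₀) :
    CMDiffAt ∞ (T% (mlieBracket I X Y)) x₀ := by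
  have : CompleteSpace E := FiniteDimensional.complete ℝ E
  have : IsManifold I (minSmoothness ℝ 2) M := by
    rw [minSmoothness_of_isRCLikeNormedField]
    infer_instance
  have : IsManifold I (minSmoothness ℝ 3) M := by
    rw [minSmoothness_of_isRCLikeNormedField]
    exact IsManifold.of_le (n := ∞) (WithTop.coe_le_coe.mpr (le_top : (3 : ℕ∞) ≤ ⊤))
  have h : ((⊤ : ℕ∞) : ℕ∞ω) + 1 = ∞ := by exact_mod_cast top_add (1 : ℕ∞)
  have : IsManifold I (((⊤ : ℕ∞) : ℕ∞ω) + 1) M := by rwa [h]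
  exact ContMDiffAt.mlieBracket_vectorField (n := ⊤) (m := ⊤) hX hY
    (by rw [h, minSmoothness_of_isRCLikeNormedField])

/-- A section of the endomorphism bundle is smooth if its values on smooth vector fields are. -/
theorem contMDiffAt_endo [FiniteDimensional ℝ E] {L : Π x : M, TangentSpace I x →L[ℝ] TangentSpace I x}
    {x₀ : M} (h : ∀ X : Π x : M, TangentSpace I x, CMDiffAt ∞ (T% X) x₀ →
      CMDiffAt ∞ (T% (fun x ↦ L x (X x))) x₀) :
    ContMDiffAt I (I.prod 𝓘(ℝ, E →L[ℝ] E)) ∞ (fun x ↦ TotalSpace.mk' (E →L[ℝ] E)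
      (E := fun x : M ↦ TangentSpace I x →L[ℝ] TangentSpace I x) x (L x)) x₀ := by
  rw [contMDiffAt_hom_bundle]
  refine ⟨contMDiffAt_id, contMDiffAt_of_apply fun v ↦ ?_⟩
  have hx₀ := FiberBundle.mem_baseSet_trivializationAt' (F := E) (E := (TangentSpace I : M → Type _)) x₀
  -- The test fields are constant in the trivialization at `x₀`, so their images under `L` are the
  -- columns of `L` in coordinates.
  have h2 : CMDiffAt ∞ (T% (fun x ↦ (trivializationAt E (TangentSpace I : M → Type _) x₀).symmL ℝ x v)) x₀ := by
    refine ((trivializationAt E (TangentSpace I : M → Type _) x₀).contMDiffAt_section_iff hx₀).2 ?_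
    refine (contMDiffAt_const (c := v)).congr_of_eventuallyEq ?_
    filter_upwards [(trivializationAt E (TangentSpace I : M → Type _) x₀).open_baseSet.mem_nhds hx₀] with x hx
    rw [Trivialization.symmL_apply _ hx, Trivialization.apply_mk_symm _ hx]
  have h3 := ((trivializationAt E (TangentSpace I : M → Type _) x₀).contMDiffAt_section_iff hx₀).1 (h _ h2)
  refine h3.congr_of_eventuallyEq ?_
  filter_upwards [(trivializationAt E (TangentSpace I : M → Type _) x₀).open_baseSet.mem_nhds hx₀] with x hx
  rw [ContinuousLinearMap.inCoordinates_eq hx hx]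
  simp [Trivialization.symmL_apply _ hx]

variable [RiemannianBundle (fun x : M ↦ TangentSpace I x)]
  [IsContMDiffRiemannianBundle I ∞ E (fun x : M ↦ TangentSpace I x)] [FiniteDimensional ℝ E]

/-- A vector field is smooth if its inner products with smooth vector fields are. -/
theorem contMDiffAt_of_inner {W : Π x : M, TangentSpace I x} {x₀ : M}
    (h : ∀ Z : Π x : M, TangentSpace I x, CMDiffAt ∞ (T% Z) x₀ →
      CMDiffAt ∞ (fun x ↦ ⟪W x, Z x⟫_ℝ) x₀) : CMDiffAt ∞ (T% W) x₀ := by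
  let e := trivializationAt E (TangentSpace I : M → Type _) x₀
  have hx₀ : x₀ ∈ e.baseSet := FiberBundle.mem_baseSet_trivializationAt' x₀
  let b := Module.finBasis ℝ E
  let s := e.localFrame b
  have hs : ∀ i, CMDiffAt ∞ (T% (s i)) x₀ := fun i ↦ contMDiffAt_localFrame_of_mem ∞ e b i hx₀
  let G : M → Matrix _ _ ℝ := fun x ↦ Matrix.gram ℝ fun i ↦ s i x
  have hG : ∀ i j, CMDiffAt ∞ (fun x ↦ G x i j) x₀ := fun i j ↦
    ContMDiffAt.inner_bundle (F := E) (E := fun x : M ↦ TangentSpace I x) (hs i) (hs j)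
  have hdet : ∀ x ∈ e.baseSet, (G x).det ≠ 0 := fun x hx ↦ by
    have := (e.isLocalFrameOn_localFrame_baseSet I ∞ b).linearIndependent hx
    exact (Matrix.posDef_gram_of_linearIndependent this).det_pos.ne'
  refine (contMDiffAt_iff_localFrameCoeff (e := e) b hx₀).mpr fun i ↦ ?_
  -- The frame coefficients of `W` solve a linear system whose matrix is the Gram matrix of the
  -- frame; Cramer's rule expresses them through smooth functions.
  have key : ∀ x ∈ e.baseSet, e.localFrameCoeff I b i x (W x) =
      ((G x).updateCol i fun j ↦ ⟪W x, s j x⟫_ℝ).det / (G x).det := by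
    intro x hx
    have h1 : (G x).mulVec (fun i ↦ e.localFrameCoeff I b i x (W x)) = fun j ↦ ⟪W x, s j x⟫_ℝ := by
      ext j
      have h2 := congrArg (fun v ↦ ⟪v, s j x⟫_ℝ) (e.eq_sum_localFrameCoeff_smul (I := I) (s := W) (b := b) hx)
      simp only [sum_inner, real_inner_smul_left] at h2
      rw [h2]
      change ∑ k, G x j k * e.localFrameCoeff I b k x (W x) = _
      exact Finset.sum_congr rfl fun k _ ↦ by
        rw [mul_comm]
        exact congrArg (_ * ·) (real_inner_comm (s k x) (s j x))
    rw [eq_div_iff (hdet x hx), ← Matrix.cramer_apply, ← h1, Matrix.cramer_eq_adjugate_mulVec,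
      Matrix.mulVec_mulVec, Matrix.adjugate_mul, Matrix.smul_mulVec, Matrix.one_mulVec, mul_comm]
    rfl
  have h2 : CMDiffAt ∞ (fun x ↦ ((G x).updateCol i fun j ↦ ⟪W x, s j x⟫_ℝ).det / (G x).det) x₀ := by
    refine (contMDiffAt_matrix_det fun j k ↦ ?_).div₀ (contMDiffAt_matrix_det hG) (hdet x₀ hx₀)
    by_cases hk : k = i
    · subst hk
      simpa using h _ (hs j)
    · simpa [hk] using hG j k
  exact h2.congr_of_eventuallyEq
    (Filter.eventually_of_mem (e.open_baseSet.mem_nhds hx₀) key)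

theorem ContMDiffAt.eventually_mdiffAt {Y : Π x : M, TangentSpace I x} {x₀ : M}
    (hY : CMDiffAt ∞ (T% Y) x₀) : ∀ᶠ x in 𝓝 x₀, MDiffAt (T% Y) x := by
  have h := (contMDiffAt_iff_contMDiffAt_nhds (by simp)).mp (hY.of_le (m := 1) (by simp))
  filter_upwards [h] with x hx using hx.mdifferentiableAt one_ne_zero

theorem contMDiffAt_inner {X Y : Π x : M, TangentSpace I x} {x₀ : M}
    (hX : CMDiffAt ∞ (T% X) x₀) (hY : CMDiffAt ∞ (T% Y) x₀) :
    CMDiffAt ∞ (fun x ↦ ⟪X x, Y x⟫_ℝ) x₀ :=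
  ContMDiffAt.inner_bundle (F := E) (E := fun x : M ↦ TangentSpace I x) hX hY

/-- The Levi-Civita connection maps smooth vector fields to smooth vector fields. -/
theorem contMDiffAt_leviCivita {X Y : Π x : M, TangentSpace I x} {x₀ : M}
    (hY : CMDiffAt ∞ (T% Y) x₀) (hX : CMDiffAt ∞ (T% X) x₀) :
    CMDiffAt ∞ (T% (fun x ↦ leviCivita I M Y x (X x))) x₀ := by
  refine contMDiffAt_of_inner fun Z hZ ↦ ?_
  have h : CMDiffAt ∞ (fun x ↦ 1 / 2 * koszul I Y X Z x) x₀ := by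
    refine contMDiffAt_const.mul ?_
    exact (((((contMDiffAt_inner hY hZ).mvfderiv_apply hX).add
      ((contMDiffAt_inner hX hZ).mvfderiv_apply hY)).sub
      ((contMDiffAt_inner hX hY).mvfderiv_apply hZ)).add
      (contMDiffAt_inner (hX.mlieBracket_smooth hY) hZ)).sub
      (contMDiffAt_inner (hX.mlieBracket_smooth hZ) hY) |>.sub
      (contMDiffAt_inner (hY.mlieBracket_smooth hZ) hX)
  refine h.congr_of_eventuallyEq ?_
  filter_upwards [hX.eventually_mdiffAt, hY.eventually_mdiffAt, hZ.eventually_mdiffAt]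
    with x h1 h2 h3 using inner_leviCivitaFun h1 h2 h3

end Smoothness

end

/-! ### The connection `∇^g + T/2` and its characteristic properties. -/

noncomputable section

namespace AlmostContactMetricSpace

variable {n : ℕ} {V : Type*} [NormedAddCommGroup V] [InnerProductSpace ℝ V]

/-- The only possible torsion of a characteristic connection in terms of `α = ∇^g Φ`. -/
def charTorsion (A : AlmostContactMetricSpace n V) (α : Tensor3 V) : Tensor3 V :=
  .ofFun fun X Y Z ↦ -(α X Y (A.φ Z) + α Y (A.φ Z) X - α (A.φ Z) X Y)
    - A.η Z * (α A.ξ X (A.φ Y) + α X (A.φ Y) A.ξ - α (A.φ Y) A.ξ X)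

variable {A : AlmostContactMetricSpace n V}

theorem charTorsion_apply (α : Tensor3 V) (X Y Z : V) : A.charTorsion α X Y Z =
    -(α X Y (A.φ Z) + α Y (A.φ Z) X - α (A.φ Z) X Y)
    - A.η Z * (α A.ξ X (A.φ Y) + α X (A.φ Y) A.ξ - α (A.φ Y) A.ξ X) := rfl

/-- Writing `Z = -φ²Z + η(Z)ξ` reduces everything to `IsCharTorsion.apply_φ` and `T(X, Y, ξ) = T(ξ,
X, Y)`; the latter is treated likewise in `Y`, as `T(ξ, X, ξ) = 0`. The explicit formula gives
smoothness of `T`, which a pointwise existence statement would not. -/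
theorem IsCharTorsion.eq_charTorsion {α T : Tensor3 V} (h : A.IsCharTorsion α T)
    (hT : IsThreeForm T) : T = A.charTorsion α := by
  ext X Y Z
  have h0 : T A.ξ X A.ξ = 0 := by linarith [hT.cyc A.ξ X A.ξ, hT.1 X A.ξ A.ξ, hT.2 X A.ξ A.ξ]
  rw [charTorsion_apply, ← h.apply_φ hT, ← h.apply_φ hT, A.φ_φ, A.φ_φ]
  simp only [map_add, map_neg, map_smul, smul_eq_mul, h0]
  rw [hT.cyc A.ξ X Y]
  ring

variable [FiniteDimensional ℝ V]

/-- The `V`-valued bilinear map with `⟨T♯(Y)(X), Z⟩ = T(X, Y, Z)`. -/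
def tensorSharp (T : Tensor3 V) : V →L[ℝ] V →L[ℝ] V :=
  LinearMap.toContinuousLinearMap
  { toFun := fun Y ↦ LinearMap.toContinuousLinearMap (sharp (T.flip Y))
    map_add' := fun Y Y' ↦ by simp
    map_smul' := fun c Y ↦ by simp }

theorem inner_tensorSharp (T : Tensor3 V) (X Y Z : V) : ⟪tensorSharp T Y X, Z⟫_ℝ = T X Y Z :=
  inner_sharp (T.flip Y) X Z

end AlmostContactMetricSpace

namespace AlmostContactMetricStructure

open AlmostContactMetricSpace

variable {n : ℕ} {E : Type*} [NormedAddCommGroup E] [NormedSpace ℝ E] [FiniteDimensional ℝ E]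
  {H : Type*} [TopologicalSpace H] {I : ModelWithCorners ℝ E H}
  {M : Type*} [TopologicalSpace M] [ChartedSpace H M] [IsManifold I ∞ M]
  [RiemannianBundle (fun x : M ↦ TangentSpace I x)]
  [IsContMDiffRiemannianBundle I ∞ E (fun x : M ↦ TangentSpace I x)]
  (A : AlmostContactMetricStructure n I M)

section Smooth

variable {A} {X Y Z : Π x : M, TangentSpace I x} {x₀ : M}

theorem contMDiffAt_apply_φ (hY : CMDiffAt ∞ (T% Y) x₀) :
    CMDiffAt ∞ (T% (fun x ↦ (A.fiber x).φ (Y x))) x₀ :=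
  ContMDiffAt.clm_bundle_apply (F₁ := E) (F₂ := E) (E₁ := fun x : M ↦ TangentSpace I x)
    (E₂ := fun x : M ↦ TangentSpace I x) (b := fun y ↦ y) A.contMDiff_φ.contMDiffAt hY

theorem contMDiffAt_apply_η (hY : CMDiffAt ∞ (T% Y) x₀) :
    CMDiffAt ∞ (fun x ↦ (A.fiber x).η (Y x)) x₀ := by
  simp only [← inner_ξ]
  exact contMDiffAt_inner hY A.contMDiff_ξ.contMDiffAt

theorem contMDiffAt_nablaΦ (hX : CMDiffAt ∞ (T% X) x₀) (hY : CMDiffAt ∞ (T% Y) x₀)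
    (hZ : CMDiffAt ∞ (T% Z) x₀) : CMDiffAt ∞ (fun x ↦ A.nablaΦ x (X x) (Y x) (Z x)) x₀ := by
  have h := (((contMDiffAt_inner hY (contMDiffAt_apply_φ (A := A) hZ)).mvfderiv_apply hX).sub
    (contMDiffAt_inner (contMDiffAt_leviCivita hY hX) (contMDiffAt_apply_φ (A := A) hZ))).sub
    (contMDiffAt_inner hY (contMDiffAt_apply_φ (A := A) (contMDiffAt_leviCivita hZ hX)))
  refine h.congr_of_eventuallyEq ?_
  filter_upwards [hY.eventually_mdiffAt, hZ.eventually_mdiffAt] with x h2 h3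
    using A.nablaΦ_apply h2 h3

theorem contMDiffAt_charTorsion (hX : CMDiffAt ∞ (T% X) x₀) (hY : CMDiffAt ∞ (T% Y) x₀)
    (hZ : CMDiffAt ∞ (T% Z) x₀) :
    CMDiffAt ∞ (fun x ↦ (A.fiber x).charTorsion (A.nablaΦ x) (X x) (Y x) (Z x)) x₀ := by
  have hξ : CMDiffAt ∞ (T% (fun x ↦ (A.fiber x).ξ)) x₀ := A.contMDiff_ξ.contMDiffAt
  have hφY := contMDiffAt_apply_φ (A := A) hY
  have hφZ := contMDiffAt_apply_φ (A := A) hZ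
  exact (((contMDiffAt_nablaΦ (A := A) hX hY hφZ).add (contMDiffAt_nablaΦ hY hφZ hX)).sub
    (contMDiffAt_nablaΦ hφZ hX hY)).neg.sub ((contMDiffAt_apply_η hZ).mul
    (((contMDiffAt_nablaΦ hξ hX hφY).add (contMDiffAt_nablaΦ hX hφY hξ)).sub
      (contMDiffAt_nablaΦ hφY hξ hX)))

end Smooth

/-- `(∇^g_v Φ)(Y, Z) = ⟨Y, (∇^g_v φ) Z⟩`. -/
theorem nablaΦ_eq_inner {Y Z : Π x : M, TangentSpace I x} {x : M} (hY : MDiffAt (T% Y) x)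
    (hZ : MDiffAt (T% Z) x) (v : TangentSpace I x) :
    A.nablaΦ x v (Y x) (Z x) =
      ⟪Y x, leviCivita I M (fun y ↦ (A.fiber y).φ (Z y)) x v
        - (A.fiber x).φ (leviCivita I M Z x v)⟫_ℝ := by
  have h1 := A.nablaΦ_apply (X := extend E v) hY hZ
  have h2 := leviCivita_metric.mvfderiv_inner_eq (extend E v) hY (A.mdiffAt_φ hZ)
  simp only [extend_apply_self] at h1 h2
  rw [h1, inner_sub_right]
  simp only [AlmostContactMetricSpace.Φ]
  rw [h2]
  ring

/-- The connection `∇^g + T / 2`, where `T` is the only possible torsion of a characteristic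
connection. -/
def charConnection : CovariantDerivative I E (TangentSpace I : M → Type _) :=
  (leviCivita I M).addOneForm fun x ↦
    tensorSharp ((1 / 2 : ℝ) • (A.fiber x).charTorsion (A.nablaΦ x))

theorem charConnection_apply (Y : Π x : M, TangentSpace I x) (x : M) (v : TangentSpace I x) :
    A.charConnection Y x v = leviCivita I M Y x v +
      tensorSharp ((1 / 2 : ℝ) • (A.fiber x).charTorsion (A.nablaΦ x)) (Y x) v := rfl

theorem inner_charConnection (Y : Π x : M, TangentSpace I x) (x : M) (v w : TangentSpace I x) :
    ⟪A.charConnection Y x v, w⟫_ℝ = ⟪leviCivita I M Y x v, w⟫_ℝ +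
      1 / 2 * (A.fiber x).charTorsion (A.nablaΦ x) v (Y x) w := by
  rw [charConnection_apply, inner_add_left, inner_tensorSharp]
  rfl

theorem contMDiff_charConnection :
    CovariantDerivative.ContMDiffCovariantDerivative A.charConnection ∞ := by
  refine ⟨⟨fun {Y} hY ↦ ?_⟩⟩
  intro x₀ _
  have hY' : CMDiffAt ∞ (T% Y) x₀ := by
    have := (hY x₀ trivial).contMDiffAt Filter.univ_mem
    exact this.of_le (by simp)
  refine ContMDiffAt.contMDiffWithinAt (contMDiffAt_endo fun X hX ↦ contMDiffAt_of_inner fun Z hZ ↦ ?_)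
  have h : CMDiffAt ∞ (fun x ↦ ⟪leviCivita I M Y x (X x), Z x⟫_ℝ +
      1 / 2 * (A.fiber x).charTorsion (A.nablaΦ x) (X x) (Y x) (Z x)) x₀ :=
    (contMDiffAt_inner (contMDiffAt_leviCivita hY' hX) hZ).add
      (contMDiffAt_const.mul (contMDiffAt_charTorsion hX hY' hZ))
  simpa only [← inner_charConnection] using h

theorem inner_torsion_charConnection {x : M}
    (hT : IsThreeForm ((A.fiber x).charTorsion (A.nablaΦ x))) (u v w : TangentSpace I x) :
    ⟪A.charConnection.torsion x u v, w⟫_ℝ = (A.fiber x).charTorsion (A.nablaΦ x) u v w := by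
  have hu : MDiffAt (T% (extend E u : Π y : M, TangentSpace I y)) x := mdifferentiableAt_extend ..
  have hv : MDiffAt (T% (extend E v : Π y : M, TangentSpace I y)) x := mdifferentiableAt_extend ..
  have h1 := A.charConnection.torsion_apply hu hv
  have h2 := (CovariantDerivative.torsion_eq_zero_iff _).mp
    (leviCivita_torsion (I := I) (M := M)) hu hv
  simp only [extend_apply_self] at h1 h2
  rw [h1, ← h2, inner_sub_left, inner_sub_left, inner_sub_left, inner_charConnection,
    inner_charConnection, extend_apply_self, extend_apply_self, hT.1 v u w]
  ring

theorem isCharacteristicConnection_charConnection (h : ∀ x, A.nablaΦ x ∈ (A.fiber x).charSpace) :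
    A.IsCharacteristicConnection A.charConnection := by
  have hT : ∀ x, IsThreeForm ((A.fiber x).charTorsion (A.nablaΦ x)) ∧
      (A.fiber x).IsCharTorsion (A.nablaΦ x) ((A.fiber x).charTorsion (A.nablaΦ x)) := fun x ↦ by
    obtain ⟨T, h1, h2⟩ := h x
    rw [← h2.eq_charTorsion h1]
    exact ⟨h1, h2⟩
  have hmet : CovariantDerivative.IsMetricCompatible (V := fun x : M ↦ TangentSpace I x)
      A.charConnection := by
    rw [CovariantDerivative.isMetricCompatible_iff]
    intro x X Y Z hX hY hZ
    rw [leviCivita_metric.mvfderiv_inner_eq X hY hZ]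
    simp only []
    rw [real_inner_comm _ (Y x), real_inner_comm _ (Y x), inner_charConnection,
      inner_charConnection, (hT x).1.2 _ (Z x)]
    ring
  have hφ : ∀ (x : M) (Y : Π x : M, TangentSpace I x), MDiffAt (T% Y) x →
      ∀ v, A.charConnection (fun y ↦ (A.fiber y).φ (Y y)) x v =
        (A.fiber x).φ (A.charConnection Y x v) := by
    intro x Y hY v
    refine ext_inner_right ℝ fun w ↦ ?_
    have h1 := A.nablaΦ_eq_inner (Y := extend E w) (mdifferentiableAt_extend ..) hY v
    rw [extend_apply_self, real_inner_comm, inner_sub_left, (hT x).2] at h1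
    rw [inner_φ_left, inner_charConnection, inner_charConnection]
    rw [inner_φ_left] at h1
    linarith [(hT x).1.2 v w ((A.fiber x).φ (Y x)), (hT x).1.2 v ((A.fiber x).φ w) (Y x)]
  have hξd : ∀ x, MDiffAt (T% (fun y ↦ (A.fiber y).ξ)) x := fun x ↦
    A.contMDiff_ξ.mdifferentiableAt (by simp)
  have hξ : ∀ (x : M) v, A.charConnection (fun y ↦ (A.fiber y).ξ) x v = 0 := by
    intro x v
    -- Differentiating `φξ = 0` gives `φ(∇ξ) = 0`, and differentiating `|ξ|² = 1` gives `η(∇ξ) = 0`;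
    -- together with the formula for `φ²` they force `∇ξ = 0`.
    have h0 : (fun y ↦ (A.fiber y).φ (A.fiber y).ξ) = (0 : Π x : M, TangentSpace I x) := by
      ext y; exact φ_ξ _
    have h1 := hφ x _ (hξd x) v
    rw [h0, CovariantDerivative.zero] at h1
    have h2 := hmet.mvfderiv_inner_eq (extend E v) (hξd x) (hξd x)
    simp only [extend_apply_self, inner_ξ, (A.fiber _).η_ξ, mvfderiv_const] at h2
    rw [real_inner_comm, inner_ξ] at h2
    have h3 := (A.fiber x).φ_φ (A.charConnection (fun y ↦ (A.fiber y).ξ) x v)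
    have h4 : (A.fiber x).η (A.charConnection (fun y ↦ (A.fiber y).ξ) x v) = 0 := by
      simp at h2
      linarith
    rw [← h1, h4] at h3
    simpa using h3
  refine ⟨A.contMDiff_charConnection, hmet, hφ, hξ, fun x Y hY v ↦ ?_, fun x u v w ↦ ?_⟩
  · have h2 := hmet.mvfderiv_inner_eq (extend E v) hY (hξd x)
    simpa only [extend_apply_self, inner_ξ, hξ, inner_zero_right, add_zero] using h2
  · rw [inner_torsion_charConnection _ (hT x).1, inner_torsion_charConnection _ (hT x).1,
      (hT x).1.2]

/-! ### Necessity, and the torsion in the `H`-parallel case. -/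

section Converse

variable {A} {conn : CovariantDerivative I E (TangentSpace I : M → Type _)}

/-- The torsion of a connection as a `(0,3)`-tensor. -/
def torsionTensor (conn : CovariantDerivative I E (TangentSpace I : M → Type _)) (x : M) :
    Tensor3 (TangentSpace I x) :=
  .ofFun (fun X Y Z ↦ ⟪conn.torsion x X Y, Z⟫_ℝ)
    (by intros; simp [inner_add_left]) (by intros; simp [real_inner_smul_left])
    (by intros; simp [inner_add_left]) (by intros; simp [real_inner_smul_left])
    (by intros; simp [inner_add_right]) (by intros; simp [real_inner_smul_right])

theorem IsCharacteristicConnection.isThreeForm (h : A.IsCharacteristicConnection conn) (x : M) :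
    IsThreeForm (torsionTensor conn x) := by
  refine ⟨fun X Y Z ↦ ?_, fun X Y Z ↦ h.skew_torsion x X Y Z⟩
  simp only [torsionTensor, Tensor3.ofFun_apply]
  rw [conn.torsion_antisymm, inner_neg_left]

/-- Both connections are metric, so their difference `D` is skew; as `∇^g` is torsion free, the
torsion is the antisymmetrization of `D`. The Koszul permutation argument, with `T` totally skew,
leaves `D = T/2`. -/
theorem IsCharacteristicConnection.inner_eq (h : A.IsCharacteristicConnection conn)
    {Y : Π x : M, TangentSpace I x} {x : M} (hY : MDiffAt (T% Y) x) (v w : TangentSpace I x) :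
    ⟪conn Y x v, w⟫_ℝ = ⟪leviCivita I M Y x v, w⟫_ℝ +
      1 / 2 * torsionTensor conn x v (Y x) w := by
  let D := conn.isCovariantDerivativeOnUniv.difference
    (leviCivita I M).isCovariantDerivativeOnUniv x
  have hD : ∀ {Y : Π x : M, TangentSpace I x}, MDiffAt (T% Y) x →
      ∀ v, D (Y x) v = conn Y x v - leviCivita I M Y x v := fun hY v ↦ by
    exact congrArg (· v) (conn.isCovariantDerivativeOnUniv.difference_apply
      (leviCivita I M).isCovariantDerivativeOnUniv (hσ := hY))
  have hs : ∀ u v w, ⟪D v u, w⟫_ℝ = -⟪D w u, v⟫_ℝ := fun u v w ↦ by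
    have hv : MDiffAt (T% (extend E v : Π y : M, TangentSpace I y)) x := mdifferentiableAt_extend ..
    have hw : MDiffAt (T% (extend E w : Π y : M, TangentSpace I y)) x := mdifferentiableAt_extend ..
    have h1 := h.parallel_g.mvfderiv_inner_eq (extend E u) hv hw
    have h2 := leviCivita_metric.mvfderiv_inner_eq (extend E u) hv hw
    have h3 := hD hv u
    have h4 := hD hw u
    simp only [extend_apply_self] at h1 h2 h3 h4
    rw [h3, h4, inner_sub_left, inner_sub_left]
    rw [real_inner_comm _ v] at h1 h2
    linarith
  have ht : ∀ u v w, torsionTensor conn x u v w = ⟪D v u, w⟫_ℝ - ⟪D u v, w⟫_ℝ := fun u v w ↦ by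
    have hu : MDiffAt (T% (extend E u : Π y : M, TangentSpace I y)) x := mdifferentiableAt_extend ..
    have hv : MDiffAt (T% (extend E v : Π y : M, TangentSpace I y)) x := mdifferentiableAt_extend ..
    have h1 := conn.torsion_apply hu hv
    have h2 := (CovariantDerivative.torsion_eq_zero_iff _).mp
      (leviCivita_torsion (I := I) (M := M)) hu hv
    have h3 := hD hv u
    have h4 := hD hu v
    simp only [extend_apply_self] at h1 h2 h3 h4
    rw [h3, h4, torsionTensor, Tensor3.ofFun_apply, h1, ← h2, ← inner_sub_left]
    congr 1
    abel
  have hsk := (h.isThreeForm x).2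
  have key : ⟪D (Y x) v, w⟫_ℝ = 1 / 2 * torsionTensor conn x v (Y x) w := by
    have k1 := hsk v (Y x) w
    have k2 := hsk w (Y x) v
    have k3 := hsk (Y x) v w
    simp only [ht] at k1 k2 k3 ⊢
    linarith [hs v (Y x) w, hs (Y x) v w, hs w v (Y x)]
  rw [hD hY, inner_sub_left] at key
  linarith

theorem IsCharacteristicConnection.isCharTorsion (h : A.IsCharacteristicConnection conn) (x : M) :
    (A.fiber x).IsCharTorsion (A.nablaΦ x) (torsionTensor conn x) := fun u v w ↦ by
  have hv : MDiffAt (T% (extend E v : Π y : M, TangentSpace I y)) x := mdifferentiableAt_extend ..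
  have hw : MDiffAt (T% (extend E w : Π y : M, TangentSpace I y)) x := mdifferentiableAt_extend ..
  have h1 := A.nablaΦ_eq_inner hv hw u
  have h2 := h.inner_eq (A.mdiffAt_φ hw) u v
  have h3 := h.inner_eq hw u ((A.fiber x).φ v)
  rw [h.parallel_φ x _ hw, inner_φ_left] at h2
  simp only [extend_apply_self] at h1 h2 h3
  rw [h1, real_inner_comm, inner_sub_left, inner_φ_left]
  linarith [(h.isThreeForm x).2 u v ((A.fiber x).φ w), (h.isThreeForm x).2 u ((A.fiber x).φ v) w]

/-- By cyclicity the left side is `η(T(X, Y))`, and `∇η = 0` turns `η(∇_X Y)` into `X(η(Y))`. -/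
theorem IsCharacteristicConnection.torsionTensor_ξ (h : A.IsCharacteristicConnection conn)
    {X Y : Π x : M, TangentSpace I x} {x : M} (hX : MDiffAt (T% X) x) (hY : MDiffAt (T% Y) x) :
    torsionTensor conn x (A.fiber x).ξ (X x) (Y x) = A.dη X Y x := by
  rw [(h.isThreeForm x).cyc, torsionTensor, Tensor3.ofFun_apply, inner_ξ, conn.torsion_apply hX hY,
    map_sub, map_sub, dη, h.parallel_η x Y hY, h.parallel_η x X hX]

theorem IsCharacteristicConnection.torsionEq (h : A.IsCharacteristicConnection conn)
    (hA : A.IsHParallel) : TorsionEq conn A.etaWedgeDEta := by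
  intro x X Y Z hX hY hZ
  have h1 := (h.isCharTorsion x).apply_of_horizontalPart_eq_zero (h.isThreeForm x)
    (horizontalPart_eq_zero (hA x)) (X x) (Y x) (Z x)
  rw [h.torsionTensor_ξ hY hZ, h.torsionTensor_ξ hZ hX, h.torsionTensor_ξ hX hY] at h1
  exact h1

variable (A)

theorem admitsCharacteristicConnection_iff :
    A.AdmitsCharacteristicConnection ↔ A.IsOfClass fun x ↦ (A.fiber x).charSpace :=
  ⟨fun ⟨_, h⟩ x ↦ ⟨_, h.isThreeForm x, h.isCharTorsion x⟩,
    fun h ↦ ⟨_, A.isCharacteristicConnection_charConnection h⟩⟩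

theorem admitsCharacteristicConnection_iff_of_isHParallel (hA : A.IsHParallel) :
    A.AdmitsCharacteristicConnection ↔
      A.IsOfClass fun x ↦ (A.fiber x).C6 ⊔ (A.fiber x).C7 ⊔ (A.fiber x).Cmin := by
  rw [admitsCharacteristicConnection_iff]
  exact ⟨fun h x ↦ mem_sup_of_horizontalPart_eq_zero (h x) (horizontalPart_eq_zero (hA x)),
    fun h x ↦ sup_le (sup_le C6_le_charSpace C7_le_charSpace) Cmin_le_charSpace (h x)⟩

theorem admitsCharacteristicConnection_iff_sup :
    A.AdmitsCharacteristicConnection ↔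
      A.IsOfClass fun x ↦ (A.fiber x).C1 ⊔ (A.fiber x).C3 ⊔ (A.fiber x).C4 ⊔
        (A.fiber x).C6 ⊔ (A.fiber x).C7 ⊔ (A.fiber x).Cmin := by
  rw [admitsCharacteristicConnection_iff]
  exact ⟨fun h x ↦ AlmostContactMetricSpace.charSpace_eq_sup.le (h x),
    fun h x ↦ AlmostContactMetricSpace.charSpace_eq_sup.ge (h x)⟩

end Converse

end AlmostContactMetricStructure

end

theorem theorem4p6 (n : ℕ) {M : Type*} [TopologicalSpace M]
    [ChartedSpace (EuclideanSpace ℝ (Fin (2 * n + 1))) M]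
    [IsManifold (𝓡 (2 * n + 1)) ∞ M]
    [RiemannianBundle (fun x : M ↦ TangentSpace (𝓡 (2 * n + 1)) x)]
    [IsContMDiffRiemannianBundle (𝓡 (2 * n + 1)) ∞ (EuclideanSpace ℝ (Fin (2 * n + 1)))
      (fun x : M ↦ TangentSpace (𝓡 (2 * n + 1)) x)]
    (A : AlmostContactMetricStructure n (𝓡 (2 * n + 1)) M) :
    (A.IsHParallel →
      ((A.AdmitsCharacteristicConnection ↔
          A.IsOfClass fun x ↦ (A.fiber x).C6 ⊔ (A.fiber x).C7 ⊔ (A.fiber x).Cmin) ∧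
        ∀ conn, A.IsCharacteristicConnection conn →
          AlmostContactMetricStructure.TorsionEq conn A.etaWedgeDEta)) ∧
    (A.AdmitsCharacteristicConnection ↔
      A.IsOfClass fun x ↦ (A.fiber x).C1 ⊔ (A.fiber x).C3 ⊔ (A.fiber x).C4 ⊔
        (A.fiber x).C6 ⊔ (A.fiber x).C7 ⊔ (A.fiber x).Cmin) := by
  refine ⟨fun hA ↦ ⟨A.admitsCharacteristicConnection_iff_of_isHParallel hA,
    fun conn h ↦ h.torsionEq hA⟩, A.admitsCharacteristicConnection_iff_sup⟩
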